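/- Let $K$ be a field, let $Q'$ and $Q''$ be quivers with finitely many vertices, and let $I'\subseteq KQ'$ and $I''\subseteq KQ''$ be two-sided ideals of the path algebras. Put $B=KQ'/I'$ and $C=KQ''/I''$. Let $v$ be a vertex of $Q'$ and $w$ a vertex of $Q''$, and let $Q$ be the quiver obtained from the disjoint union of $Q'$ and $Q''$ by adding one new arrow $w\to v$. Let $I$ be the two-sided ideal of $KQ$ generated by $I'$ and $I''$, and let $\Lambda=KQ/I$. (Paths are multiplied like functions, so that left modules are covariant representations of the quiver and $\Lambda$ is the upper triangular matrix algebra $\begin{pmatrix} B & M\\ 0 & C\end{pmatrix}$, where $M$ is spanned by the classes of the paths from $Q''$ to $Q'$.) A $K$-algebra $\Gamma$ is called Gorenstein if it is finite-dimensional, the left module $D(\Gamma_\Gamma)=\operatorname{Hom}_K(\Gamma,K)$ has finite projective dimension, and the left module $\Gamma$ has finite injective dimension. A left $\Gamma$-module $G$ is Gorenstein projective if $G\cong\operatorname{Ker} d^0$ for an exact sequence $\cdots\to P^{-1}\to P^0\xrightarrow{d^0}P^1\to\cdots$ of finitely generated projective left $\Gamma$-modules which stays exact under $\operatorname{Hom}_\Gamma(-,\Gamma)$.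 The stable category $\underline{\operatorname{Gproj}}(\Gamma)$ has the Gorenstein projective modules as objects, and homomorphisms modulo those that factor through finitely generated projective modules as morphisms. Its suspension $\Sigma X$ is the cokernel of an embedding of $X$ into a finitely generated projective module with Gorenstein projective cokernel, and its distinguished triangles are, up to isomorphism, those $X\to Y\to Z\to\Sigma X$ that come from short exact sequences $0\to X\to Y\to Z\to 0$ of Gorenstein projective modules. Suppose that $B$ and $C$ are Gorenstein. Then there is a $K$-linear triangle equivalence $$\underline{\operatorname{Gproj}}(\Lambda)\;\simeq\;\underline{\operatorname{Gproj}}(B)\coprod\underline{\operatorname{Gproj}}(C),$$ where the coproduct on the right is the product category with componentwise suspension and componentwise distinguished triangles. -/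

import Mathlib

open CategoryTheory

universe u

noncomputable section

/-! ## Path algebras -/

/-- The path algebra `KQ` of a quiver `Q` with finite vertex set `V`: an element assigns to every
pair of vertices `(a, b)` a finite `K`-linear combination of paths from `a` to `b`.  As `V` is
finite, the paths of `Q` form a `K`-basis. -/
def PathAlgebra (K V : Type u) [Field K] [Quiver.{u} V] : Type u :=
  ∀ a b : V, Quiver.Path a b →₀ K

namespace PathAlgebra

variable (K V : Type u) [Field K] [Quiver.{u} V]

instance : AddCommGroup (PathAlgebra K V) :=
  inferInstanceAs (AddCommGroup (∀ a b : V, Quiver.Path a b →₀ K))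

instance : Module K (PathAlgebra K V) :=
  inferInstanceAs (Module K (∀ a b : V, Quiver.Path a b →₀ K))

variable {K V}

@[ext]
theorem ext {x y : PathAlgebra K V} (h : ∀ a b, x a b = y a b) : x = y :=
  funext fun a => funext fun b => h a b

/-- The bilinear extension of the concatenation of paths: first `p`, then `q`. -/
def concat {a b c : V} (f : Quiver.Path a b →₀ K) (g : Quiver.Path b c →₀ K) :
    Quiver.Path a c →₀ K :=
  f.sum fun p s => g.sum fun q t => Finsupp.single (p.comp q) (s * t)

/-- The trivial path at `a`, if `a = b`. -/
def trivialPath (K : Type u) [Field K] (a b : V) : Quiver.Path a b →₀ K :=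
  open Classical in
  if h : a = b then Finsupp.single (h ▸ Quiver.Path.nil) 1 else 0

theorem concat_add_left {a b c : V} (f f' : Quiver.Path a b →₀ K) (g : Quiver.Path b c →₀ K) :
    concat (f + f') g = concat f g + concat f' g := by
  unfold concat
  rw [Finsupp.sum_add_index']
  · intro p; simp
  · intro p s s'
    simp only [add_mul, Finsupp.single_add, Finsupp.sum_add]

theorem concat_add_right {a b c : V} (f : Quiver.Path a b →₀ K) (g g' : Quiver.Path b c →₀ K) :
    concat f (g + g') = concat f g + concat f g' := by
  unfold concat
  rw [← Finsupp.sum_add]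
  congr 1
  funext p s
  rw [Finsupp.sum_add_index']
  · intro q; simp
  · intro q t t'
    simp only [mul_add, Finsupp.single_add]

@[simp] theorem concat_zero_left {a b c : V} (g : Quiver.Path b c →₀ K) :
    concat (0 : Quiver.Path a b →₀ K) g = 0 := by
  simp [concat]

@[simp] theorem concat_zero_right {a b c : V} (f : Quiver.Path a b →₀ K) :
    concat f (0 : Quiver.Path b c →₀ K) = 0 := by
  simp [concat]

@[simp] theorem concat_single {a b c : V} (p : Quiver.Path a b) (q : Quiver.Path b c) (s t : K) :
    concat (Finsupp.single p s) (Finsupp.single q t) = Finsupp.single (p.comp q) (s * t) := by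
  simp [concat]

theorem concat_smul_left {a b c : V} (r : K) (f : Quiver.Path a b →₀ K)
    (g : Quiver.Path b c →₀ K) : concat (r • f) g = r • concat f g := by
  induction f using Finsupp.induction_linear with
  | zero => simp
  | add f f' h h' => rw [smul_add, concat_add_left, h, h', concat_add_left, smul_add]
  | single p s =>
    induction g using Finsupp.induction_linear with
    | zero => simp
    | add g g' h h' => rw [concat_add_right, h, h', concat_add_right, smul_add]
    | single q t => simp only [Finsupp.smul_single', concat_single, mul_assoc]

theorem concat_smul_right {a b c : V} (r : K) (f : Quiver.Path a b →₀ K)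
    (g : Quiver.Path b c →₀ K) : concat f (r • g) = r • concat f g := by
  induction f using Finsupp.induction_linear with
  | zero => simp
  | add f f' h h' => rw [concat_add_left, h, h', concat_add_left, smul_add]
  | single p s =>
    induction g using Finsupp.induction_linear with
    | zero => simp
    | add g g' h h' => rw [smul_add, concat_add_right, h, h', concat_add_right, smul_add]
    | single q t => simp only [Finsupp.smul_single', concat_single, mul_left_comm]

theorem concat_assoc {a b c d : V} (f : Quiver.Path a b →₀ K) (g : Quiver.Path b c →₀ K)
    (h : Quiver.Path c d →₀ K) : concat (concat f g) h = concat f (concat g h) := by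
  induction f using Finsupp.induction_linear with
  | zero => simp
  | add f f' h h' => simp only [concat_add_left, h, h']
  | single p s =>
    induction g using Finsupp.induction_linear with
    | zero => simp
    | add g g' h h' => simp only [concat_add_left, concat_add_right, h, h']
    | single q t =>
      induction h using Finsupp.induction_linear with
      | zero => simp
      | add g g' h h' => simp only [concat_add_right, h, h']
      | single r t' => simp only [concat_single, Quiver.Path.comp_assoc, mul_assoc]

theorem concat_sum_left {a b c : V} {ι : Type*} (s : Finset ι) (f : ι → Quiver.Path a b →₀ K)
    (g : Quiver.Path b c →₀ K) : concat (∑ i ∈ s, f i) g = ∑ i ∈ s, concat (f i) g :=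
  map_sum (AddMonoidHom.mk' (fun f => concat f g) fun f f' => concat_add_left f f' g) f s

theorem concat_sum_right {a b c : V} {ι : Type*} (s : Finset ι) (f : Quiver.Path a b →₀ K)
    (g : ι → Quiver.Path b c →₀ K) : concat f (∑ i ∈ s, g i) = ∑ i ∈ s, concat f (g i) :=
  map_sum (AddMonoidHom.mk' (fun g => concat f g) fun g g' => concat_add_right f g g') g s

theorem trivialPath_self (a : V) :
    trivialPath K a a = Finsupp.single Quiver.Path.nil 1 := by
  simp [trivialPath]

theorem trivialPath_ne {a b : V} (h : a ≠ b) : trivialPath K a b = 0 := by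
  simp [trivialPath, h]

@[simp] theorem trivialPath_concat {a b : V} (f : Quiver.Path a b →₀ K) :
    concat (trivialPath K a a) f = f := by
  rw [trivialPath_self]
  induction f using Finsupp.induction_linear with
  | zero => simp
  | add f f' h h' => simp only [concat_add_right, h, h']
  | single p s => simp

@[simp] theorem concat_trivialPath {a b : V} (f : Quiver.Path a b →₀ K) :
    concat f (trivialPath K b b) = f := by
  rw [trivialPath_self]
  induction f using Finsupp.induction_linear with
  | zero => simp
  | add f f' h h' => simp only [concat_add_left, h, h']
  | single p s => simp

instance : One (PathAlgebra K V) := ⟨fun a b => trivialPath K a b⟩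

theorem one_apply (a b : V) : (1 : PathAlgebra K V) a b = trivialPath K a b := rfl

theorem add_apply (x y : PathAlgebra K V) (a b : V) : (x + y) a b = x a b + y a b := rfl

theorem zero_apply (a b : V) : (0 : PathAlgebra K V) a b = 0 := rfl

theorem smul_apply (r : K) (x : PathAlgebra K V) (a b : V) : (r • x) a b = r • x a b := rfl

variable [Fintype V]

/-- The product of two paths is `x * y = (first y, then x)`, or `0` if they do not compose; so
left modules are covariant representations of the quiver. -/
instance : Mul (PathAlgebra K V) := ⟨fun x y a c => ∑ b : V, concat (y a b) (x b c)⟩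

theorem mul_apply (x y : PathAlgebra K V) (a c : V) :
    (x * y) a c = ∑ b : V, concat (y a b) (x b c) := rfl

instance : Ring (PathAlgebra K V) :=
  { (inferInstance : AddCommGroup (PathAlgebra K V)) with
    left_distrib := fun x y z => by
      ext1 a c
      simp only [mul_apply, add_apply, concat_add_left, Finset.sum_add_distrib]
    right_distrib := fun x y z => by
      ext1 a c
      simp only [mul_apply, add_apply, concat_add_right, Finset.sum_add_distrib]
    zero_mul := fun x => by
      ext1 a c
      simp [mul_apply, zero_apply]
    mul_zero := fun x => by
      ext1 a c
      simp [mul_apply, zero_apply]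
    mul_assoc := fun x y z => by
      ext1 a d
      simp only [mul_apply, concat_sum_left, concat_sum_right, concat_assoc]
      exact Finset.sum_comm
    one_mul := fun x => by
      ext1 a c
      rw [mul_apply, Finset.sum_eq_single c]
      · rw [one_apply, concat_trivialPath]
      · intro b _ hb
        rw [one_apply, trivialPath_ne hb, concat_zero_right]
      · simp
    mul_one := fun x => by
      ext1 a c
      rw [mul_apply, Finset.sum_eq_single a]
      · rw [one_apply, trivialPath_concat]
      · intro b _ hb
        rw [one_apply, trivialPath_ne hb.symm, concat_zero_left]
      · simp }

instance : Algebra K (PathAlgebra K V) :=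
  Algebra.ofModule
    (fun r x y => by
      ext1 a c
      simp only [mul_apply, smul_apply, concat_smul_right, Finset.smul_sum])
    (fun r x y => by
      ext1 a c
      simp only [mul_apply, smul_apply, concat_smul_left, Finset.smul_sum])

end PathAlgebra

/-- The algebra `KQ/I` given by a quiver with a two-sided ideal `I` of its path algebra. -/
abbrev BoundQuiverAlgebra {K V : Type u} [Field K] [Quiver.{u} V] [Fintype V]
    (I : TwoSidedIdeal (PathAlgebra K V)) : Type u :=
  I.ringCon.Quotient

/-! ## Gluing two quivers by one arrow -/

/-- The vertices of the quiver glued from the quivers on `V'` and `V''` by one arrow `w ⟶ v`. -/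
def GluedVertex {V' V'' : Type u} (_v : V') (_w : V'') : Type u := V' ⊕ V''

/-- The arrows of the glued quiver: those of the two quivers and one new arrow `w ⟶ v`. -/
inductive GluedArrow {V' V'' : Type u} [Quiver.{u} V'] [Quiver.{u} V''] (v : V') (w : V'') :
    V' ⊕ V'' → V' ⊕ V'' → Type u
  | left {a b : V'} (f : a ⟶ b) : GluedArrow v w (Sum.inl a) (Sum.inl b)
  | right {a b : V''} (f : a ⟶ b) : GluedArrow v w (Sum.inr a) (Sum.inr b)
  | bridge : GluedArrow v w (Sum.inr w) (Sum.inl v)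

section Glue

variable {V' V'' : Type u} [Quiver.{u} V'] [Quiver.{u} V''] (v : V') (w : V'')

instance : Quiver.{u} (GluedVertex v w) := ⟨GluedArrow v w⟩

instance [Fintype V'] [Fintype V''] : Fintype (GluedVertex v w) :=
  inferInstanceAs (Fintype (V' ⊕ V''))

/-- The inclusion of the quiver `Q'` into the glued quiver. -/
def gluedInl : V' ⥤q GluedVertex v w where
  obj a := Sum.inl a
  map f := GluedArrow.left f

/-- The inclusion of the quiver `Q''` into the glued quiver. -/
def gluedInr : V'' ⥤q GluedVertex v w where
  obj a := Sum.inr a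
  map f := GluedArrow.right f

variable {K : Type u} [Field K]

/-- The inclusion `KQ' → KQ`, which sends each path of `Q'` to the same path in `Q`. -/
def pathAlgebraInl (x : PathAlgebra K V') : PathAlgebra K (GluedVertex v w)
  | Sum.inl a, Sum.inl b => Finsupp.mapDomain (fun p => (gluedInl v w).mapPath p) (x a b)
  | _, _ => 0

/-- The inclusion `KQ'' → KQ`, which sends each path of `Q''` to the same path in `Q`. -/
def pathAlgebraInr (x : PathAlgebra K V'') : PathAlgebra K (GluedVertex v w)
  | Sum.inr a, Sum.inr b => Finsupp.mapDomain (fun p => (gluedInr v w).mapPath p) (x a b)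
  | _, _ => 0

/-- The two-sided ideal of `KQ` generated by `I'` and `I''`. -/
def gluedIdeal [Fintype V'] [Fintype V''] (I' : TwoSidedIdeal (PathAlgebra K V'))
    (I'' : TwoSidedIdeal (PathAlgebra K V'')) :
    TwoSidedIdeal (PathAlgebra K (GluedVertex v w)) :=
  TwoSidedIdeal.span
    (pathAlgebraInl v w '' (I' : Set (PathAlgebra K V')) ∪
      pathAlgebraInr v w '' (I'' : Set (PathAlgebra K V'')))

end Glue

/-! ## Gorenstein algebras and Gorenstein projective modules -/

/-- The left module `D(Γ_Γ) = Hom_K(Γ, K)`, with `(a • φ) x = φ (x * a)`. -/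
def RegularDual (K Γ : Type u) [Field K] [Ring Γ] [Algebra K Γ] : Type u := Γ →ₗ[K] K

section RegularDual

variable (K Γ : Type u) [Field K] [Ring Γ] [Algebra K Γ]

instance : AddCommGroup (RegularDual K Γ) := inferInstanceAs (AddCommGroup (Γ →ₗ[K] K))

instance : Module Γ (RegularDual K Γ) where
  smul a φ := LinearMap.comp (R₁ := K) (M₁ := Γ) (M₂ := Γ) (M₃ := K) φ (LinearMap.mulRight K a)
  one_smul φ := LinearMap.ext fun x => by
    let ψ : Γ →ₗ[K] K := φ
    have h : ψ (x * 1) = ψ x := by rw [mul_one]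
    exact h
  mul_smul a b φ := LinearMap.ext fun x => by
    let ψ : Γ →ₗ[K] K := φ
    have h : ψ (x * (a * b)) = ψ (x * a * b) := by rw [mul_assoc]
    exact h
  smul_zero _ := rfl
  smul_add _ _ _ := rfl
  add_smul a b φ := LinearMap.ext fun x => by
    let ψ : Γ →ₗ[K] K := φ
    have h : ψ (x * (a + b)) = ψ (x * a) + ψ (x * b) := by rw [mul_add, map_add]
    exact h
  zero_smul φ := LinearMap.ext fun x => by
    let ψ : Γ →ₗ[K] K := φ
    have h : ψ (x * 0) = 0 := by rw [mul_zero, map_zero]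
    exact h

end RegularDual

/-- A finite-dimensional `K`-algebra `Γ` is Gorenstein if the left module `D(Γ_Γ)` has finite
projective dimension and the left module `Γ` has finite injective dimension. -/
structure IsGorensteinAlgebra (K Γ : Type u) [Field K] [Ring Γ] [Algebra K Γ] : Prop where
  finite : Module.Finite K Γ
  projectiveDimension : ∃ n : ℕ, HasProjectiveDimensionLE (ModuleCat.of Γ (RegularDual K Γ)) n
  injectiveDimension : ∃ n : ℕ, HasInjectiveDimensionLE (ModuleCat.of Γ Γ) n

variable (Γ : Type u) [Ring Γ]

/-- `G` is Gorenstein projective: it is isomorphic to `Ker d⁰` for an exact sequence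
`⋯ → P⁻¹ → P⁰ → P¹ → ⋯` of finitely generated projective left modules which stays exact under
`Hom(-, Γ)`. -/
def IsGorensteinProjective (G : ModuleCat.{u} Γ) : Prop :=
  ∃ (P : ℤ → ModuleCat.{u} Γ) (d : ∀ n : ℤ, P n →ₗ[Γ] P (n + 1)),
    (∀ n, Module.Finite Γ (P n)) ∧ (∀ n, Module.Projective Γ (P n)) ∧
    (∀ n, Function.Exact (d n) (d (n + 1))) ∧
    (∀ n, Function.Exact (fun g : P (n + 1 + 1) →ₗ[Γ] Γ => g ∘ₗ d (n + 1))
      (fun g : P (n + 1) →ₗ[Γ] Γ => g ∘ₗ d n)) ∧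
    Nonempty (G ≃ₗ[Γ] LinearMap.ker (d 0))

/-- The property of being Gorenstein projective. -/
def gprojProperty : ObjectProperty (ModuleCat.{u} Γ) := fun G => IsGorensteinProjective Γ G

/-- The category of (finitely generated) Gorenstein projective left `Γ`-modules. -/
abbrev GProj : Type (u + 1) := (gprojProperty Γ).FullSubcategory

variable {Γ}

/-! ## The stable category -/

/-- The homomorphism `f` factors through a finitely generated projective module. -/
def FactorsThroughProjective {M N : ModuleCat.{u} Γ} (f : M ⟶ N) : Prop :=
  ∃ (P : ModuleCat.{u} Γ) (_ : Module.Finite Γ P) (_ : Module.Projective Γ P)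
    (a : M ⟶ P) (b : P ⟶ N), f = a ≫ b

namespace FactorsThroughProjective

variable {L M N : ModuleCat.{u} Γ}

theorem zero : FactorsThroughProjective (0 : M ⟶ N) :=
  ⟨ModuleCat.of Γ PUnit, inferInstance, inferInstance, 0, 0, by simp⟩

theorem neg {f : M ⟶ N} (hf : FactorsThroughProjective f) : FactorsThroughProjective (-f) := by
  obtain ⟨P, h1, h2, a, b, rfl⟩ := hf
  exact ⟨P, h1, h2, -a, b, by simp⟩

theorem add {f g : M ⟶ N} (hf : FactorsThroughProjective f) (hg : FactorsThroughProjective g) :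
    FactorsThroughProjective (f + g) := by
  obtain ⟨P, h1, h2, a, b, rfl⟩ := hf
  obtain ⟨Q, h3, h4, c, d, rfl⟩ := hg
  refine ⟨ModuleCat.of Γ (P × Q), inferInstance, inferInstance,
    ModuleCat.ofHom (a.hom.prod c.hom), ModuleCat.ofHom (b.hom.coprod d.hom), ?_⟩
  ext x
  simp

theorem comp_left (h : L ⟶ M) {f : M ⟶ N} (hf : FactorsThroughProjective f) :
    FactorsThroughProjective (h ≫ f) := by
  obtain ⟨P, h1, h2, a, b, rfl⟩ := hf
  exact ⟨P, h1, h2, h ≫ a, b, by simp⟩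

theorem comp_right {f : L ⟶ M} (hf : FactorsThroughProjective f) (h : M ⟶ N) :
    FactorsThroughProjective (f ≫ h) := by
  obtain ⟨P, h1, h2, a, b, rfl⟩ := hf
  exact ⟨P, h1, h2, a, b ≫ h, by simp⟩

theorem smul {K : Type u} [Field K] [Algebra K Γ] (r : K) {f : M ⟶ N}
    (hf : FactorsThroughProjective f) : FactorsThroughProjective (r • f) := by
  obtain ⟨P, h1, h2, a, b, rfl⟩ := hf
  exact ⟨P, h1, h2, r • a, b, by simp⟩

end FactorsThroughProjective

variable (Γ)

/-- Two homomorphisms are stably equal if their difference factors through a projective. -/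
def stableRel : HomRel (GProj Γ) := fun _ _ f g => FactorsThroughProjective (f.hom - g.hom)

variable {Γ} in
theorem stableRel_iff {X Y : GProj Γ} (f g : X ⟶ Y) :
    stableRel Γ f g ↔ FactorsThroughProjective (f.hom - g.hom) := Iff.rfl

instance : Congruence (stableRel Γ) where
  equivalence :=
    { refl := fun f => by rw [stableRel_iff, sub_self]; exact .zero
      symm := fun {f g} h => by
        rw [stableRel_iff] at h ⊢
        simpa using h.neg
      trans := fun {f g k} h h' => by
        rw [stableRel_iff] at h h' ⊢
        simpa using h.add h' }
  comp_left f g g' h := by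
    rw [stableRel_iff] at h ⊢
    simpa using h.comp_left f.hom
  comp_right g h := by
    rw [stableRel_iff] at h ⊢
    simpa using h.comp_right g.hom

/-- The stable category of Gorenstein projective left `Γ`-modules. -/
def StableGProj : Type (u + 1) := CategoryTheory.Quotient (stableRel Γ)

namespace StableGProj

instance : Category.{u} (StableGProj Γ) :=
  inferInstanceAs (Category (CategoryTheory.Quotient (stableRel Γ)))

/-- The projection from Gorenstein projective modules to their stable category. -/
def proj : GProj Γ ⥤ StableGProj Γ := CategoryTheory.Quotient.functor (stableRel Γ)

theorem stableRel_add {X Y : GProj Γ} (f₁ f₂ g₁ g₂ : X ⟶ Y) (h : stableRel Γ f₁ f₂)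
    (h' : stableRel Γ g₁ g₂) : stableRel Γ (f₁ + g₁) (f₂ + g₂) := by
  rw [stableRel_iff] at h h' ⊢
  convert h.add h' using 1
  exact add_sub_add_comm f₁.hom g₁.hom f₂.hom g₂.hom

instance : Preadditive (StableGProj Γ) :=
  CategoryTheory.Quotient.preadditive (stableRel Γ) (fun _ _ => stableRel_add Γ)

instance : (proj Γ).Additive :=
  CategoryTheory.Quotient.functor_additive (stableRel Γ) (fun _ _ => stableRel_add Γ)

instance (K : Type u) [Field K] [Algebra K Γ] : Linear K (StableGProj Γ) :=
  letI : Preadditive (CategoryTheory.Quotient (stableRel Γ)) :=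
    inferInstanceAs (Preadditive (StableGProj Γ))
  letI : (CategoryTheory.Quotient.functor (stableRel Γ)).Additive :=
    inferInstanceAs ((proj Γ).Additive)
  CategoryTheory.Quotient.linear K (stableRel Γ) (fun r X Y f g h => by
    rw [stableRel_iff] at h ⊢
    convert h.smul r using 1
    rw [smul_sub]
    rfl)

end StableGProj

/-! ## The suspension of the stable category -/

/-- An exact sequence `0 → X → J → S → 0` with `J` finitely generated projective and `S`
Gorenstein projective; every homomorphism from `X` to a finitely generated projective module
extends to `J`.  Such a sequence exists for every `X` (see `nonempty_cosyzygy`). -/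
structure Cosyzygy {Γ : Type u} [Ring Γ] (X : GProj Γ) where
  J : ModuleCat.{u} Γ
  S : GProj Γ
  ι : X.obj ⟶ J
  π : J ⟶ S.obj
  finite : Module.Finite Γ J
  projective : Module.Projective Γ J
  injective : Function.Injective ι.hom
  exact : Function.Exact ι.hom π.hom
  surjective : Function.Surjective π.hom
  extend : ∀ (Q : ModuleCat.{u} Γ), Module.Finite Γ Q → Module.Projective Γ Q →
    ∀ f : X.obj ⟶ Q, ∃ g : J ⟶ Q, ι ≫ g = f

section Suspension

variable {Γ}

theorem exists_desc {A B C N : ModuleCat.{u} Γ} {i : A ⟶ B} {p : B ⟶ C}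
    (hip : Function.Exact i.hom p.hom) (hp : Function.Surjective p.hom) (k : B ⟶ N)
    (hk : i ≫ k = 0) : ∃ s : C ⟶ N, p ≫ s = k := by
  have hle : LinearMap.ker p.hom ≤ LinearMap.ker k.hom := by
    intro x hx
    obtain ⟨y, rfl⟩ := (hip x).1 hx
    have := congrArg (fun f => f.hom y) hk
    simpa using this
  refine ⟨ModuleCat.ofHom (((LinearMap.ker p.hom).liftQ k.hom hle).comp
    (LinearMap.quotKerEquivOfSurjective p.hom hp).symm.toLinearMap), ?_⟩
  ext x
  have h : (LinearMap.quotKerEquivOfSurjective p.hom hp).symm (p.hom x) =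
      (LinearMap.ker p.hom).mkQ x := by
    rw [LinearEquiv.symm_apply_eq]
    rfl
  simp only [ModuleCat.hom_comp, ModuleCat.hom_ofHom, LinearMap.comp_apply,
    LinearEquiv.coe_coe, h, Submodule.mkQ_apply, Submodule.liftQ_apply]

theorem nonempty_cosyzygy (X : GProj Γ) : Nonempty (Cosyzygy X) := by
  obtain ⟨P, d, hfin, hproj, hex, hdual, ⟨e₀⟩⟩ := X.property
  have hker : ∀ m : ℤ, m = 0 → Nonempty (X.obj ≃ₗ[Γ] LinearMap.ker (d m)) := by
    rintro _ rfl
    exact ⟨e₀⟩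
  have hker' : ∀ m : ℤ, m = 0 + 1 →
      Nonempty (LinearMap.ker (d m) ≃ₗ[Γ] LinearMap.ker (d (0 + 1))) := by
    rintro _ rfl
    exact ⟨LinearEquiv.refl _ _⟩
  obtain ⟨n, hn⟩ : ∃ n : ℤ, n + 1 + 1 = 0 := ⟨-2, by norm_num⟩
  obtain ⟨e⟩ := hker (n + 1 + 1) hn
  have hS : IsGorensteinProjective Γ (ModuleCat.of Γ (LinearMap.ker (d (n + 1 + 1 + 1)))) :=
    ⟨fun k => P (k + 1), fun k => d (k + 1), fun k => hfin _, fun k => hproj _,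
      fun k => hex _, fun k => hdual _, hker' _ (by rw [hn])⟩
  have hdd : ∀ x, d (n + 1 + 1 + 1) (d (n + 1 + 1) x) = 0 := fun x =>
    (hex (n + 1 + 1)).apply_apply_eq_zero x
  let i : X.obj →ₗ[Γ] P (n + 1 + 1) := (LinearMap.ker (d (n + 1 + 1))).subtype ∘ₗ e.toLinearMap
  have hi : ∀ x, d (n + 1 + 1) (i x) = 0 := fun x => (e x).2
  have hi' : ∀ z : P (n + 1 + 1), d (n + 1 + 1) z = 0 → ∃ x, i x = z := fun z hz =>
    ⟨e.symm ⟨z, hz⟩, by simp [i]⟩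
  have hinj : Function.Injective i := Subtype.val_injective.comp e.injective
  -- extension of homomorphisms with values in `Γ`
  have key : ∀ f : X.obj →ₗ[Γ] Γ, ∃ g : P (n + 1 + 1) →ₗ[Γ] Γ, g ∘ₗ i = f := by
    intro f
    let q : P (n + 1) →ₗ[Γ] X.obj := e.symm.toLinearMap ∘ₗ
      (LinearMap.codRestrict (LinearMap.ker (d (n + 1 + 1))) (d (n + 1))
        (fun x => (hex (n + 1)).apply_apply_eq_zero x))
    have hiq : ∀ x, i (q x) = d (n + 1) x := fun x => by
      simp only [i, q, LinearMap.comp_apply, LinearEquiv.coe_coe, LinearEquiv.apply_symm_apply]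
      rfl
    have hfq : (f ∘ₗ q) ∘ₗ d n = 0 := by
      ext x
      have : q (d n x) = 0 := by
        apply hinj
        rw [hiq, map_zero]
        exact (hex n).apply_apply_eq_zero x
      simp [this]
    obtain ⟨g, hg⟩ := (hdual n (f ∘ₗ q)).1 hfq
    have hg' : ∀ x, g (d (n + 1) x) = f (q x) := fun x => LinearMap.congr_fun hg x
    refine ⟨g, ?_⟩
    ext x
    obtain ⟨y, hy⟩ := (hex (n + 1) (i x)).1 (hi x)
    have hxy : q y = x := by
      apply hinj
      rw [hiq]
      exact hy
    change g (i x) = f x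
    rw [← hxy, hiq, hg']
  refine ⟨{
    J := P (n + 1 + 1)
    S := ⟨ModuleCat.of Γ (LinearMap.ker (d (n + 1 + 1 + 1))), hS⟩
    ι := ModuleCat.ofHom i
    π := ModuleCat.ofHom (LinearMap.codRestrict (LinearMap.ker (d (n + 1 + 1 + 1))) (d (n + 1 + 1)) hdd)
    finite := hfin _
    projective := hproj _
    injective := hinj
    exact := ?_
    surjective := ?_
    extend := ?_ }⟩
  · intro z
    constructor
    · intro hz
      exact hi' z (congrArg Subtype.val hz)
    · rintro ⟨x, rfl⟩
      exact Subtype.ext (hi x)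
  · rintro ⟨z, hz⟩
    obtain ⟨y, hy⟩ := (hex (n + 1 + 1) z).1 hz
    exact ⟨y, Subtype.ext hy⟩
  · intro Q hQ hQ' f
    obtain ⟨r, p, hp⟩ := Module.Finite.exists_fin' Γ Q
    obtain ⟨s, hs⟩ := Module.projective_lifting_property p LinearMap.id hp
    choose g hg using fun j : Fin r => key (LinearMap.proj j ∘ₗ s ∘ₗ f.hom)
    refine ⟨ModuleCat.ofHom (p ∘ₗ LinearMap.pi g), ?_⟩
    ext x
    have h1 : LinearMap.pi g (i x) = s (f.hom x) := by
      funext j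
      exact LinearMap.congr_fun (hg j) x
    change p (LinearMap.pi g (i x)) = f.hom x
    rw [h1]
    exact LinearMap.congr_fun hs _

/-- A chosen sequence `0 → X → J → S → 0`. -/
def cosyzygy (X : GProj Γ) : Cosyzygy X := (nonempty_cosyzygy X).some

namespace Cosyzygy

variable {X Y Z : GProj Γ}

theorem ι_π (c : Cosyzygy X) : c.ι ≫ c.π = 0 := by
  ext x
  exact c.exact.apply_apply_eq_zero x

theorem hom_ext_π (c : Cosyzygy X) {N : ModuleCat.{u} Γ} {s t : c.S.obj ⟶ N}
    (h : c.π ≫ s = c.π ≫ t) : s = t := by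
  ext y
  obtain ⟨x, rfl⟩ := c.surjective y
  exact congrArg (fun f => f.hom x) h

/-- The homomorphism `s` of cosyzygies is induced by `f`, through a morphism of the two exact
sequences. -/
def Induces (c : Cosyzygy X) (c' : Cosyzygy Y) (f : X ⟶ Y) (s : c.S ⟶ c'.S) : Prop :=
  ∃ e : c.J ⟶ c'.J, c.ι ≫ e = f.hom ≫ c'.ι ∧ c.π ≫ s.hom = e ≫ c'.π

theorem exists_induces (c : Cosyzygy X) (c' : Cosyzygy Y) (f : X ⟶ Y) :
    ∃ s : c.S ⟶ c'.S, Induces c c' f s := by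
  obtain ⟨e, he⟩ := c.extend c'.J c'.finite c'.projective (f.hom ≫ c'.ι)
  obtain ⟨s, hs⟩ := exists_desc c.exact c.surjective (e ≫ c'.π) (by
    rw [← Category.assoc, he, Category.assoc, ι_π, Limits.comp_zero])
  exact ⟨ObjectProperty.homMk s, e, he, hs⟩

theorem Induces.id (c : Cosyzygy X) : Induces c c (𝟙 X) (𝟙 c.S) :=
  ⟨𝟙 _, by simp, by simp⟩

theorem Induces.comp {c : Cosyzygy X} {c' : Cosyzygy Y} {c'' : Cosyzygy Z} {f : X ⟶ Y}
    {g : Y ⟶ Z} {s : c.S ⟶ c'.S} {t : c'.S ⟶ c''.S} (h : Induces c c' f s)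
    (h' : Induces c' c'' g t) : Induces c c'' (f ≫ g) (s ≫ t) := by
  obtain ⟨e, he, he'⟩ := h
  obtain ⟨k, hk, hk'⟩ := h'
  refine ⟨e ≫ k, ?_, ?_⟩
  · rw [← Category.assoc, he, Category.assoc, hk, ObjectProperty.FullSubcategory.comp_hom,
      Category.assoc]
  · rw [ObjectProperty.FullSubcategory.comp_hom, ← Category.assoc, he', Category.assoc, hk',
      Category.assoc]

/-- Stably equal homomorphisms induce stably equal homomorphisms of cosyzygies. -/
theorem Induces.stableRel {c : Cosyzygy X} {c' : Cosyzygy Y} {f g : X ⟶ Y} {s t : c.S ⟶ c'.S}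
    (hf : Induces c c' f s) (hg : Induces c c' g t) (hfg : stableRel Γ f g) :
    stableRel Γ s t := by
  obtain ⟨e, he, he'⟩ := hf
  obtain ⟨k, hk, hk'⟩ := hg
  obtain ⟨P, h1, h2, a, b, hab⟩ := hfg
  obtain ⟨a', ha'⟩ := c.extend P h1 h2 a
  obtain ⟨m, hm⟩ := exists_desc c.exact c.surjective (e - k - a' ≫ b ≫ c'.ι) (by
    rw [Preadditive.comp_sub, Preadditive.comp_sub, he, hk, ← Category.assoc c.ι, ha',
      ← Preadditive.sub_comp, hab, Category.assoc, sub_self])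
  refine ⟨c'.J, c'.finite, c'.projective, m, c'.π, c.hom_ext_π ?_⟩
  rw [← Category.assoc, hm, Preadditive.comp_sub, he', hk', Preadditive.sub_comp,
    Preadditive.sub_comp, Category.assoc, Category.assoc, ι_π]
  simp

end Cosyzygy

end Suspension

namespace StableGProj

/-- The map `f ↦ (the class of a homomorphism of cosyzygies induced by f)`. -/
def preSuspension : GProj Γ ⥤ StableGProj Γ where
  obj X := (proj Γ).obj (cosyzygy X).S
  map {X Y} f := (proj Γ).map ((cosyzygy X).exists_induces (cosyzygy Y) f).choose
  map_id X := by
    rw [← CategoryTheory.Functor.map_id]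
    exact CategoryTheory.Quotient.sound _
      (((cosyzygy X).exists_induces (cosyzygy X) (𝟙 X)).choose_spec.stableRel
        (Cosyzygy.Induces.id _) (Congruence.equivalence.refl _))
  map_comp {X Y Z} f g := by
    rw [← CategoryTheory.Functor.map_comp]
    exact CategoryTheory.Quotient.sound _
      (((cosyzygy X).exists_induces (cosyzygy Z) (f ≫ g)).choose_spec.stableRel
        (((cosyzygy X).exists_induces (cosyzygy Y) f).choose_spec.comp
          ((cosyzygy Y).exists_induces (cosyzygy Z) g).choose_spec)
        (Congruence.equivalence.refl _))

/-- The suspension functor `X ↦ S` of the stable category, for `0 → X → J → S → 0`. -/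
def suspension : StableGProj Γ ⥤ StableGProj Γ :=
  CategoryTheory.Quotient.lift (stableRel Γ) (preSuspension Γ) (fun X Y f g h =>
    CategoryTheory.Quotient.sound _
      (((cosyzygy X).exists_induces (cosyzygy Y) f).choose_spec.stableRel
        ((cosyzygy X).exists_induces (cosyzygy Y) g).choose_spec h))

end StableGProj

/-! ## Triangles and triangle equivalences -/

/-- A diagram `X ⟶ Y ⟶ Z ⟶ T X` for an endofunctor `T`. -/
structure SuspTriangle {C : Type*} [Category* C] (T : C ⥤ C) where
  {obj₁ obj₂ obj₃ : C}
  mor₁ : obj₁ ⟶ obj₂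
  mor₂ : obj₂ ⟶ obj₃
  mor₃ : obj₃ ⟶ T.obj obj₁

/-- Two such diagrams are isomorphic. -/
def SuspTriangle.IsIsomorphic {C : Type*} [Category* C] {T : C ⥤ C} (s t : SuspTriangle T) :
    Prop :=
  ∃ (a : s.obj₁ ≅ t.obj₁) (b : s.obj₂ ≅ t.obj₂) (c : s.obj₃ ≅ t.obj₃),
    s.mor₁ ≫ b.hom = a.hom ≫ t.mor₁ ∧ s.mor₂ ≫ c.hom = b.hom ≫ t.mor₂ ∧
    s.mor₃ ≫ T.map a.hom = c.hom ≫ t.mor₃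

/-- The data of a triangulated category: a suspension functor and the class of distinguished
triangles. -/
class TriangleData (C : Type*) [Category* C] where
  susp : C ⥤ C
  distinguished : Set (SuspTriangle susp)

/-- The standard triangle `X ⟶ Y ⟶ Z ⟶ ΣX` of an exact sequence `0 → X → Y → Z → 0` of Gorenstein
projective modules: the last morphism `w` is part of a morphism of exact sequences from
`0 → X → Y → Z → 0` to `0 → X → J → ΣX → 0` which is the identity on `X`. -/
inductive StableGProj.IsStandard : SuspTriangle (StableGProj.suspension Γ) → Prop
  | mk {X Y Z : GProj Γ} (f : X ⟶ Y) (g : Y ⟶ Z)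
      (injective : Function.Injective f.hom.hom) (exact : Function.Exact f.hom.hom g.hom.hom)
      (surjective : Function.Surjective g.hom.hom)
      (e : Y.obj ⟶ (cosyzygy X).J) (w : Z ⟶ (cosyzygy X).S)
      (he : f.hom ≫ e = (cosyzygy X).ι) (hw : g.hom ≫ w.hom = e ≫ (cosyzygy X).π) :
      StableGProj.IsStandard ⟨(proj Γ).map f, (proj Γ).map g, (proj Γ).map w⟩

/-- The triangulated structure of the stable category: the distinguished triangles are those
isomorphic to standard ones. -/
instance : TriangleData (StableGProj Γ) where
  susp := StableGProj.suspension Γ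
  distinguished := {t | ∃ s, StableGProj.IsStandard Γ s ∧ t.IsIsomorphic s}

section Coproduct

variable (C D : Type*) [Category* C] [Category* D]

/-- The coproduct of two preadditive categories is their product category. -/
instance [Preadditive C] [Preadditive D] : Preadditive (C × D) where
  homGroup X Y := inferInstanceAs (AddCommGroup ((X.1 ⟶ Y.1) × (X.2 ⟶ Y.2)))
  add_comp _ _ _ _ _ _ := Prod.ext (Preadditive.add_comp ..) (Preadditive.add_comp ..)
  comp_add _ _ _ _ _ _ := Prod.ext (Preadditive.comp_add ..) (Preadditive.comp_add ..)

instance (K : Type*) [Semiring K] [Preadditive C] [Preadditive D] [Linear K C] [Linear K D] :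
    Linear K (C × D) where
  homModule X Y := inferInstanceAs (Module K ((X.1 ⟶ Y.1) × (X.2 ⟶ Y.2)))
  smul_comp _ _ _ _ _ _ := Prod.ext (Linear.smul_comp ..) (Linear.smul_comp ..)
  comp_smul _ _ _ _ _ _ := Prod.ext (Linear.comp_smul ..) (Linear.comp_smul ..)

/-- In the coproduct, suspension and distinguished triangles are componentwise. -/
instance [TriangleData C] [TriangleData D] : TriangleData (C × D) where
  susp := (TriangleData.susp (C := C)).prod (TriangleData.susp (C := D))
  distinguished := {t |
    (⟨t.mor₁.1, t.mor₂.1, t.mor₃.1⟩ : SuspTriangle (TriangleData.susp (C := C))) ∈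
      TriangleData.distinguished ∧
    (⟨t.mor₁.2, t.mor₂.2, t.mor₃.2⟩ : SuspTriangle (TriangleData.susp (C := D))) ∈
      TriangleData.distinguished}

end Coproduct

/-- A `K`-linear triangle equivalence: a `K`-linear equivalence with a natural isomorphism
`F Σ ≅ Σ F` such that distinguished triangles are sent to distinguished triangles. -/
structure TriangleEquivalence (K : Type*) [Semiring K] (C D : Type*) [Category* C] [Category* D]
    [Preadditive C] [Preadditive D] [Linear K C] [Linear K D] [TriangleData C] [TriangleData D]
    where
  equiv : C ≌ D
  additive : equiv.functor.Additive
  linear : equiv.functor.Linear K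
  commSusp : TriangleData.susp ⋙ equiv.functor ≅ equiv.functor ⋙ TriangleData.susp
  map_distinguished : ∀ t : SuspTriangle (TriangleData.susp (C := C)),
    t ∈ TriangleData.distinguished →
      (⟨equiv.functor.map t.mor₁, equiv.functor.map t.mor₂,
        equiv.functor.map t.mor₃ ≫ commSusp.hom.app t.obj₁⟩ :
          SuspTriangle (TriangleData.susp (C := D))) ∈ TriangleData.distinguished

end


/-!
Put `S = B × C`. The algebra `Λ` arises from `S` by adjoining one arrow `a = e a f`, where the
idempotents `e` and `f` satisfy `f S e = 0`. Hence `a S a = 0`, and `Λ = S ⊕ S a S` with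
`S a S ≅ S e ⊗_K f S`; killing `a` retracts `Λ` onto `S`. Therefore `Λ ⊗_S U = U ⊕ (S e ⊗_K f U)`
is exact in `U`, and the map `S e ⊗_K f P → P`, `s ⊗ x ↦ s a x`, is injective for every projective
`Λ`-module `P`.

This injectivity passes to submodules of projective modules, so the reduction
`X ↦ S ⊗_Λ X = X / S a X` preserves exactness of `X → Y → Z` when `Z` embeds into a projective
module. It follows that reduction carries totally acyclic complexes to totally acyclic complexes:
as the kernel of `Λ → S` is projective, such a complex stays exact under `Hom_Λ(-, S)`.
For a Gorenstein projective `X` the kernel of `X → S ⊗_Λ X` is the projective module `S e ⊗_K f X`.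
Over `S` this kernel is still projective and `S ⊗_Λ X` is Gorenstein projective, so the surjection
splits over `S`, and consequently `X ≅ Λ ⊗_S (S ⊗_Λ X)`.

Hence reduction is full and dense on Gorenstein projective modules, and a map `X → Y` which it kills
factors through the projective kernel of `Y → S ⊗_Λ Y`, so that it induces a triangle equivalence
of the stable categories of `Λ` and `S`. Over `B × C` everything is componentwise.
-/

noncomputable section

open scoped TensorProduct

/-! ## Totally acyclic complexes -/

section Factorization

variable {R M N P Q : Type*} [Ring R] [AddCommGroup M] [Module R M] [AddCommGroup N] [Module R N]
  [AddCommGroup P] [Module R P] [AddCommGroup Q] [Module R Q]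

theorem exists_comp_eq_of_ker_le {p : M →ₗ[R] N} (hp : Function.Surjective p) {k : M →ₗ[R] Q}
    (hk : ∀ x, p x = 0 → k x = 0) : ∃ s : N →ₗ[R] Q, s ∘ₗ p = k := by
  refine ⟨(LinearMap.ker p).liftQ k hk ∘ₗ (p.quotKerEquivOfSurjective hp).symm, ?_⟩
  ext x
  have : (p.quotKerEquivOfSurjective hp).symm (p x) = (LinearMap.ker p).mkQ x := by
    rw [LinearEquiv.symm_apply_eq]
    rfl
  rw [LinearMap.comp_apply, LinearMap.comp_apply, LinearEquiv.coe_coe, this]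
  exact Submodule.liftQ_apply _ _ _

theorem exists_comp_eq_of_forall_mem_range {i : N →ₗ[R] Q} (hi : Function.Injective i)
    {k : M →ₗ[R] Q} (hk : ∀ x, ∃ y, i y = k x) : ∃ s : M →ₗ[R] N, i ∘ₗ s = k := by
  refine ⟨(LinearEquiv.ofInjective i hi).symm ∘ₗ k.codRestrict (LinearMap.range i) hk, ?_⟩
  ext x
  exact congrArg Subtype.val ((LinearEquiv.ofInjective i hi).apply_symm_apply ⟨k x, hk x⟩)

theorem exists_amalgamation {i : M →ₗ[R] N} {u : P →ₗ[R] N} (hiu : ∀ y, ∃ x z, i x + u z = y)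
    {f : M →ₗ[R] Q} {k : P →ₗ[R] Q} (hfk : ∀ x z, i x = u z → f x = k z) :
    ∃ g : N →ₗ[R] Q, g ∘ₗ i = f ∧ g ∘ₗ u = k := by
  obtain ⟨g, hg⟩ := exists_comp_eq_of_ker_le (p := i.coprod u) (k := f.coprod k)
    (fun y => by
      obtain ⟨x, z, h⟩ := hiu y
      exact ⟨(x, z), by simpa using h⟩)
    (fun ⟨x, z⟩ h => by
      have := hfk x (-z) (by rw [map_neg]; exact eq_neg_of_add_eq_zero_left h)
      simp [this])
  exact ⟨g, by ext x; simpa using LinearMap.congr_fun hg (x, 0),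
    by ext z; simpa using LinearMap.congr_fun hg (0, z)⟩

theorem exists_factorization_finite_free [Module.Finite R M] [Module.Projective R Q]
    (f : M →ₗ[R] Q) : ∃ (t : Finset Q) (a : M →ₗ[R] t → R) (b : (t → R) →ₗ[R] Q),
      b ∘ₗ a = f ∧ ∀ x, f x = 0 → a x = 0 := by
  classical
  obtain ⟨s, hs⟩ := Module.Projective.out (R := R) (P := Q)
  obtain ⟨S, hS⟩ := Module.Finite.fg_top (R := R) (M := M)
  let t : Finset Q := S.biUnion fun x => (s (f x)).support
  have hsupp (x : M) : s (f x) ∈ Finsupp.supported R R (t : Set Q) := by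
    have hle : Submodule.span R (S : Set M) ≤
        (Finsupp.supported R R (t : Set Q)).comap (s ∘ₗ f) :=
      Submodule.span_le.2 fun x hx => (Finsupp.mem_supported R _).2 <|
        Finset.coe_subset.2 (Finset.subset_biUnion_of_mem (fun x => (s (f x)).support) hx)
    exact hle (hS ▸ Submodule.mem_top)
  refine ⟨t, LinearMap.pi fun j => Finsupp.lapply (j : Q) ∘ₗ s ∘ₗ f,
    Fintype.linearCombination R (Subtype.val : t → Q), ?_, fun x hx => ?_⟩
  · ext x
    have h := hs (f x)
    rw [Finsupp.linearCombination_apply, Finsupp.sum_of_support_subset (s := t) _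
      ((Finsupp.mem_supported R _).1 (hsupp x)) _ (by simp)] at h
    exact (Finset.sum_coe_sort t fun j => s (f x) j • j).trans h
  · ext j
    simp [hx]

end Factorization

/-- Exact complexes of finitely generated projective modules. -/
structure AcyclicComplex (Γ : Type u) [Ring Γ] where
  X : ℤ → ModuleCat.{u} Γ
  d : ∀ n : ℤ, X n →ₗ[Γ] X (n + 1)
  finite : ∀ n, Module.Finite Γ (X n)
  projective : ∀ n, Module.Projective Γ (X n)
  exact : ∀ n, Function.Exact (d n) (d (n + 1))

namespace AcyclicComplex

variable {Γ : Type u} [Ring Γ] (P : AcyclicComplex Γ)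

/-- The exactness of `Hom(P, N)`; for `N = Γ` this says that `P` is totally acyclic. -/
def IsHomExact (N : Type*) [AddCommGroup N] [Module Γ N] : Prop :=
  ∀ n (g : P.X (n + 1) →ₗ[Γ] N), g ∘ₗ P.d n = 0 →
    ∃ h : P.X (n + 1 + 1) →ₗ[Γ] N, h ∘ₗ P.d (n + 1) = g

variable {P} {N N' N'' Q : Type*} [AddCommGroup N] [Module Γ N] [AddCommGroup N'] [Module Γ N']
  [AddCommGroup N''] [Module Γ N''] [AddCommGroup Q] [Module Γ Q]

theorem d_comp_d (n : ℤ) : P.d (n + 1) ∘ₗ P.d n = 0 := (P.exact n).linearMap_comp_eq_zero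

theorem IsHomExact.pi {ι : Type*} (h : P.IsHomExact N) : P.IsHomExact (ι → N) := by
  intro n g hg
  choose k hk using fun j => h n (LinearMap.proj j ∘ₗ g) (by rw [LinearMap.comp_assoc, hg]; simp)
  exact ⟨LinearMap.pi k, LinearMap.ext fun x => funext fun j => LinearMap.congr_fun (hk j) x⟩

/-- A map from a finitely generated module to `Q` factors through a finite free module without
enlarging its kernel, so no finiteness of `Q` is needed. -/
theorem IsHomExact.of_projective (h : P.IsHomExact Γ) [Module.Projective Γ Q] :
    P.IsHomExact Q := by
  intro n g hg
  have := P.finite (n + 1)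
  obtain ⟨t, a, b, rfl, hab⟩ := exists_factorization_finite_free g
  obtain ⟨k, hk⟩ := h.pi n a (LinearMap.ext fun x => hab _ (LinearMap.congr_fun hg x))
  exact ⟨b ∘ₗ k, by rw [LinearMap.comp_assoc, hk]⟩

theorem IsHomExact.of_exact {i : N' →ₗ[Γ] N} {p : N →ₗ[Γ] N''} (hi : Function.Injective i)
    (hip : Function.Exact i p) (hp : Function.Surjective p) (h' : P.IsHomExact N')
    (h : P.IsHomExact N) : P.IsHomExact N'' := by
  intro n g hg
  obtain ⟨m, rfl⟩ : ∃ m, n = m + 1 := ⟨n - 1, by ring⟩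
  have := P.projective (m + 1 + 1)
  obtain ⟨g', rfl⟩ := Module.projective_lifting_property p g hp
  obtain ⟨k, hk⟩ := exists_comp_eq_of_forall_mem_range hi (k := g' ∘ₗ P.d (m + 1))
    fun x => (hip _).1 (LinearMap.congr_fun hg x)
  obtain ⟨l, rfl⟩ := h' m k <| LinearMap.ext fun x => hi <| calc
    i (k (P.d m x)) = g' (P.d (m + 1) (P.d m x)) := LinearMap.congr_fun hk _
    _ = i 0 := by rw [(P.exact m).apply_apply_eq_zero, map_zero, map_zero]
  obtain ⟨q, hq⟩ := h _ (g' - i ∘ₗ l) <| by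
    rw [LinearMap.sub_comp, LinearMap.comp_assoc, hk, sub_self]
  exact ⟨p ∘ₗ q, by
    rw [LinearMap.comp_assoc, hq, LinearMap.comp_sub, ← LinearMap.comp_assoc,
      hip.linearMap_comp_eq_zero, LinearMap.zero_comp, sub_zero]⟩

theorem isGorensteinProjective_ker (h : P.IsHomExact Γ) {G : ModuleCat.{u} Γ}
    (e : G ≃ₗ[Γ] LinearMap.ker (P.d 0)) : IsGorensteinProjective Γ G := by
  refine ⟨P.X, P.d, P.finite, P.projective, P.exact, fun n g => ⟨h n g, ?_⟩, ⟨e⟩⟩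
  rintro ⟨k, rfl⟩
  exact (LinearMap.comp_assoc _ _ _).trans (by rw [d_comp_d, LinearMap.comp_zero])

theorem isGorensteinProjective_of_exact (h : P.IsHomExact Γ) {G : ModuleCat.{u} Γ}
    {i : G →ₗ[Γ] P.X 0} (hi : Function.Injective i) (hid : Function.Exact i (P.d 0)) :
    IsGorensteinProjective Γ G :=
  isGorensteinProjective_ker h <|
    (LinearEquiv.ofInjective i hi).trans (LinearEquiv.ofEq _ _ (LinearMap.exact_iff.1 hid).symm)

end AcyclicComplex

namespace IsGorensteinProjective

variable {Γ : Type u} [Ring Γ] {G Z : ModuleCat.{u} Γ}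

theorem exists_acyclicComplex (hG : IsGorensteinProjective Γ G) {n : ℤ} (hn : n = 0) :
    ∃ (P : AcyclicComplex Γ) (i : G →ₗ[Γ] P.X n), P.IsHomExact Γ ∧ Function.Injective i ∧
      Function.Exact i (P.d n) := by
  obtain ⟨X, d, finite, projective, exact, dual, ⟨e⟩⟩ := hG
  subst hn
  refine ⟨⟨X, d, finite, projective, exact⟩, (LinearMap.ker (d 0)).subtype ∘ₗ e,
    fun n g hg => (dual n g).1 hg, Subtype.val_injective.comp e.injective, fun x => ?_⟩
  exact ⟨fun hx => ⟨e.symm ⟨x, hx⟩, by simp⟩, by rintro ⟨y, rfl⟩; exact (e y).2⟩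

/-- The left half of a complete resolution. -/
theorem exists_presentation (hZ : IsGorensteinProjective Γ Z) :
    ∃ (P₀ P₁ P₂ : ModuleCat.{u} Γ) (a : P₂ →ₗ[Γ] P₁) (b : P₁ →ₗ[Γ] P₀) (c : P₀ →ₗ[Γ] Z),
      Module.Finite Γ P₀ ∧ Module.Projective Γ P₀ ∧
      Function.Exact a b ∧ Function.Exact b c ∧ Function.Surjective c ∧
      ∀ (Q : Type u) [AddCommGroup Q] [Module Γ Q] [Module.Projective Γ Q] (g : P₁ →ₗ[Γ] Q),
        g ∘ₗ a = 0 → ∃ h : P₀ →ₗ[Γ] Q, h ∘ₗ b = g := by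
  obtain ⟨P, i, hP, hi, hid⟩ := hZ.exists_acyclicComplex (show (-3 : ℤ) + 1 + 1 + 1 = 0 by norm_num)
  obtain ⟨c, hc⟩ := exists_comp_eq_of_forall_mem_range hi (k := P.d (-3 + 1 + 1))
    fun x => (hid _).1 ((P.exact _).apply_apply_eq_zero x)
  have hc (x) : i (c x) = P.d (-3 + 1 + 1) x := LinearMap.congr_fun hc x
  refine ⟨_, _, _, P.d (-3), P.d (-3 + 1), c, P.finite _, P.projective _, P.exact _,
    fun x => ?_, fun z => ?_, fun Q _ _ _ => hP.of_projective (-3)⟩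
  · rw [← P.exact (-3 + 1) x, ← hc, map_eq_zero_iff i hi]
  · obtain ⟨y, hy⟩ := (P.exact _ _).1 (hid.apply_apply_eq_zero z)
    exact ⟨y, hi (by rw [hc, hy])⟩

theorem finite (hG : IsGorensteinProjective Γ G) : Module.Finite Γ G := by
  obtain ⟨P₀, _, _, _, _, c, _, _, _, _, hc, -⟩ := hG.exists_presentation
  exact Module.Finite.of_surjective c hc

theorem exists_extension (hZ : IsGorensteinProjective Γ Z) {X Y Q : Type u} [AddCommGroup X]
    [Module Γ X] [AddCommGroup Y] [Module Γ Y] [AddCommGroup Q] [Module Γ Q]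
    [Module.Projective Γ Q] {i : X →ₗ[Γ] Y} {p : Y →ₗ[Γ] Z} (hi : Function.Injective i)
    (hip : Function.Exact i p) (hp : Function.Surjective p) (f : X →ₗ[Γ] Q) :
    ∃ g : Y →ₗ[Γ] Q, g ∘ₗ i = f := by
  obtain ⟨P₀, P₁, P₂, a, b, c, _, _, hab, hbc, hc, hQ⟩ := hZ.exists_presentation
  obtain ⟨u, hu⟩ := Module.projective_lifting_property p c hp
  have hu (x) : p (u x) = c x := LinearMap.congr_fun hu x
  obtain ⟨v, hv⟩ := exists_comp_eq_of_forall_mem_range hi (k := u ∘ₗ b)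
    fun x => (hip _).1 (by rw [LinearMap.comp_apply, hu, hbc.apply_apply_eq_zero])
  have hv (x) : i (v x) = u (b x) := LinearMap.congr_fun hv x
  obtain ⟨k, hk⟩ : ∃ k : P₀ →ₗ[Γ] Q, k ∘ₗ b = f ∘ₗ v :=
    hQ Q (f ∘ₗ v) <| LinearMap.ext fun x => by
      have : v (a x) = 0 := hi (by rw [hv, hab.apply_apply_eq_zero, map_zero, map_zero])
      simp only [LinearMap.comp_apply, this, map_zero, LinearMap.zero_apply]
  obtain ⟨g, hg, -⟩ := exists_amalgamation (i := i) (u := u) (f := f) (k := k)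
    (fun y => by
      obtain ⟨z, hz⟩ := hc (p y)
      obtain ⟨x, hx⟩ := (hip (y - u z)).1 (by rw [map_sub, hu, hz, sub_self])
      exact ⟨x, z, by rw [hx, sub_add_cancel]⟩)
    (fun x z hxz => by
      obtain ⟨y, rfl⟩ := (hbc z).1 (by rw [← hu, ← hxz, hip.apply_apply_eq_zero])
      rw [← hv] at hxz
      exact (congrArg f (hi hxz)).trans (LinearMap.congr_fun hk y).symm)
  exact ⟨g, hg⟩

end IsGorensteinProjective

/-! ## Functors between stable categories -/

namespace FactorsThroughProjective

theorem of_finite_of_projective {Γ : Type u} [Ring Γ] {M N : ModuleCat.{u} Γ} [Module.Finite Γ M]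
    [Module.Projective Γ N] (f : M ⟶ N) : FactorsThroughProjective f := by
  obtain ⟨t, a, b, h, -⟩ := exists_factorization_finite_free f.hom
  exact ⟨ModuleCat.of Γ (t → Γ), inferInstanceAs (Module.Finite Γ (t → Γ)),
    inferInstanceAs (Module.Projective Γ (t → Γ)), ModuleCat.ofHom a, ModuleCat.ofHom b,
    ModuleCat.hom_ext h.symm⟩

end FactorsThroughProjective

/-- Functors on modules which preserve Gorenstein projective modules, finitely generated
projective modules and exact sequences ending in a Gorenstein projective module. -/
structure IsStablyExact {Λ A : Type u} [Ring Λ] [Ring A]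
    (H : ModuleCat.{u} Λ ⥤ ModuleCat.{u} A) : Prop where
  gproj : ∀ G, IsGorensteinProjective Λ G → IsGorensteinProjective A (H.obj G)
  finite : ∀ P : ModuleCat.{u} Λ, Module.Finite Λ P → Module.Finite A (H.obj P)
  projective : ∀ P : ModuleCat.{u} Λ, Module.Projective Λ P → Module.Projective A (H.obj P)
  exact : ∀ {X Y Z : ModuleCat.{u} Λ} (f : X ⟶ Y) (g : Y ⟶ Z), IsGorensteinProjective Λ Z →
    Function.Injective f.hom → Function.Exact f.hom g.hom → Function.Surjective g.hom →
    Function.Injective (H.map f).hom ∧ Function.Exact (H.map f).hom (H.map g).hom ∧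
      Function.Surjective (H.map g).hom

namespace Cosyzygy

variable {Γ : Type u} [Ring Γ] {X Y : GProj Γ}

theorem Induces.proj_eq {c : Cosyzygy X} {c' : Cosyzygy Y} {f : X ⟶ Y} {s t : c.S ⟶ c'.S}
    (hs : Induces c c' f s) (ht : Induces c c' f t) :
    (StableGProj.proj Γ).map s = (StableGProj.proj Γ).map t :=
  CategoryTheory.Quotient.sound _ (hs.stableRel ht (Congruence.equivalence.refl _))

/-- The homomorphism of cosyzygies induced by the identity. -/
def compare (c c' : Cosyzygy X) : c.S ⟶ c'.S := (c.exists_induces c' (𝟙 X)).choose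

theorem compare_induces (c c' : Cosyzygy X) : Induces c c' (𝟙 X) (compare c c') :=
  (c.exists_induces c' (𝟙 X)).choose_spec

theorem map_compare_comp (c c' : Cosyzygy X) :
    (StableGProj.proj Γ).map (compare c c') ≫ (StableGProj.proj Γ).map (compare c' c) = 𝟙 _ := by
  have h := (compare_induces c c').comp (compare_induces c' c)
  rw [Category.comp_id] at h
  rw [← Functor.map_comp, ← CategoryTheory.Functor.map_id]
  exact h.proj_eq (Induces.id c)

/-- The stable isomorphism between two cosyzygies of a module. -/
def compareIso (c c' : Cosyzygy X) :
    (StableGProj.proj Γ).obj c.S ≅ (StableGProj.proj Γ).obj c'.S where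
  hom := (StableGProj.proj Γ).map (compare c c')
  inv := (StableGProj.proj Γ).map (compare c' c)
  hom_inv_id := map_compare_comp c c'
  inv_hom_id := map_compare_comp c' c

end Cosyzygy

namespace SuspTriangle

variable {C D E : Type*} [Category* C] [Category* D] [Category* E] {T : C ⥤ C} {T' : D ⥤ D}
  {T'' : E ⥤ E}

/-- The image of a triangle under a functor which commutes with the endofunctors. -/
def map (F : C ⥤ D) (α : T ⋙ F ≅ F ⋙ T') (t : SuspTriangle T) : SuspTriangle T' :=
  ⟨F.map t.mor₁, F.map t.mor₂, F.map t.mor₃ ≫ α.hom.app t.obj₁⟩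

theorem IsIsomorphic.map (F : C ⥤ D) (α : T ⋙ F ≅ F ⋙ T') {s t : SuspTriangle T}
    (h : s.IsIsomorphic t) : (s.map F α).IsIsomorphic (t.map F α) := by
  obtain ⟨a, b, c, h₁, h₂, h₃⟩ := h
  refine ⟨F.mapIso a, F.mapIso b, F.mapIso c, ?_, ?_, ?_⟩
  · simp [SuspTriangle.map, ← Functor.map_comp, h₁]
  · simp [SuspTriangle.map, ← Functor.map_comp, h₂]
  · have h := α.hom.naturality a.hom
    rw [Functor.comp_map, Functor.comp_map] at h
    simp only [SuspTriangle.map, Functor.mapIso_hom, Category.assoc]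
    rw [← h, ← Functor.map_comp_assoc, h₃, Functor.map_comp_assoc]

/-- The composition of two functors which commute with the endofunctors does so as well. -/
def compCommIso {F : C ⥤ D} {G : D ⥤ E} (α : T ⋙ F ≅ F ⋙ T') (β : T' ⋙ G ≅ G ⋙ T'') :
    T ⋙ F ⋙ G ≅ (F ⋙ G) ⋙ T'' :=
  Functor.isoWhiskerRight α G ≪≫ Functor.isoWhiskerLeft F β

theorem map_map {F : C ⥤ D} {G : D ⥤ E} (α : T ⋙ F ≅ F ⋙ T') (β : T' ⋙ G ≅ G ⋙ T'')
    (t : SuspTriangle T) : (t.map F α).map G β = t.map (F ⋙ G) (compCommIso α β) := by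
  simp [map, compCommIso]

end SuspTriangle

namespace IsStablyExact

variable {Λ A : Type u} [Ring Λ] [Ring A] {H : ModuleCat.{u} Λ ⥤ ModuleCat.{u} A}

/-- The restriction to Gorenstein projective modules. -/
def gprojFunctor (h : IsStablyExact H) : GProj Λ ⥤ GProj A :=
  (gprojProperty A).lift ((gprojProperty Λ).ι ⋙ H) fun X => h.gproj _ X.property

theorem factorsThroughProjective (h : IsStablyExact H) {M N : ModuleCat.{u} Λ} {f : M ⟶ N}
    (hf : FactorsThroughProjective f) : FactorsThroughProjective (H.map f) := by
  obtain ⟨P, finite, projective, a, b, rfl⟩ := hf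
  exact ⟨H.obj P, h.finite P finite, h.projective P projective, H.map a, H.map b,
    H.map_comp _ _⟩

theorem stableRel_map [H.Additive] (h : IsStablyExact H) {X Y : GProj Λ} {f g : X ⟶ Y}
    (hfg : stableRel Λ f g) : stableRel A (h.gprojFunctor.map f) (h.gprojFunctor.map g) := by
  rw [stableRel_iff] at hfg ⊢
  have := h.factorsThroughProjective hfg
  rwa [H.map_sub] at this

/-- The induced functor on stable categories. -/
def stableFunctor [H.Additive] (h : IsStablyExact H) : StableGProj Λ ⥤ StableGProj A :=
  CategoryTheory.Quotient.lift (stableRel Λ) (h.gprojFunctor ⋙ StableGProj.proj A)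
    fun _ _ _ _ hfg => CategoryTheory.Quotient.sound _ (h.stableRel_map hfg)

/-- The image of a cosyzygy. -/
def mapCosyzygy (h : IsStablyExact H) {X : GProj Λ} (c : Cosyzygy X) :
    Cosyzygy (h.gprojFunctor.obj X) where
  J := H.obj c.J
  S := h.gprojFunctor.obj c.S
  ι := H.map c.ι
  π := H.map c.π
  finite := h.finite _ c.finite
  projective := h.projective _ c.projective
  injective := (h.exact c.ι c.π c.S.property c.injective c.exact c.surjective).1
  exact := (h.exact c.ι c.π c.S.property c.injective c.exact c.surjective).2.1
  surjective := (h.exact c.ι c.π c.S.property c.injective c.exact c.surjective).2.2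
  extend Q _ _ f := by
    obtain ⟨h₁, h₂, h₃⟩ := h.exact c.ι c.π c.S.property c.injective c.exact c.surjective
    obtain ⟨g, hg⟩ := (h.gproj _ c.S.property).exists_extension h₁ h₂ h₃ f.hom
    exact ⟨ModuleCat.ofHom g, ModuleCat.hom_ext hg⟩

theorem mapCosyzygy_induces (h : IsStablyExact H) {X Y : GProj Λ} {c : Cosyzygy X}
    {c' : Cosyzygy Y} {f : X ⟶ Y} {s : c.S ⟶ c'.S} (hs : Cosyzygy.Induces c c' f s) :
    Cosyzygy.Induces (h.mapCosyzygy c) (h.mapCosyzygy c') (h.gprojFunctor.map f)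
      (h.gprojFunctor.map s) := by
  obtain ⟨e, he, he'⟩ := hs
  exact ⟨H.map e, (H.map_comp _ _).symm.trans ((congrArg H.map he).trans (H.map_comp _ _)),
    (H.map_comp _ _).symm.trans ((congrArg H.map he').trans (H.map_comp _ _))⟩

variable [H.Additive]

/-- The induced functor commutes with the suspensions. -/
def commSusp (h : IsStablyExact H) :
    StableGProj.suspension Λ ⋙ h.stableFunctor ≅ h.stableFunctor ⋙ StableGProj.suspension A :=
  CategoryTheory.Quotient.natIsoLift (stableRel Λ) <|
    NatIso.ofComponents (fun X => (h.mapCosyzygy (cosyzygy X)).compareIso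
      (cosyzygy (h.gprojFunctor.obj X))) <| by
      intro X Y f
      have h₁ := (h.mapCosyzygy_induces
        ((cosyzygy X).exists_induces (cosyzygy Y) f).choose_spec).comp
        ((h.mapCosyzygy (cosyzygy Y)).compare_induces (cosyzygy (h.gprojFunctor.obj Y)))
      have h₂ := ((h.mapCosyzygy (cosyzygy X)).compare_induces
        (cosyzygy (h.gprojFunctor.obj X))).comp
        ((cosyzygy (h.gprojFunctor.obj X)).exists_induces (cosyzygy (h.gprojFunctor.obj Y))
          (h.gprojFunctor.map f)).choose_spec
      rw [Category.comp_id] at h₁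
      rw [Category.id_comp] at h₂
      exact ((StableGProj.proj A).map_comp _ _).symm.trans
        ((h₁.proj_eq h₂).trans ((StableGProj.proj A).map_comp _ _))

theorem isStandard_map (h : IsStablyExact H) {t : SuspTriangle (StableGProj.suspension Λ)}
    (ht : StableGProj.IsStandard Λ t) :
    StableGProj.IsStandard A (t.map h.stableFunctor h.commSusp) := by
  obtain @⟨X, Y, Z, f, g, hf, hfg, hg, e, w, he, hw⟩ := ht
  let c := h.mapCosyzygy (cosyzygy X)
  let c' := cosyzygy (h.gprojFunctor.obj X)
  let s : H.obj (cosyzygy X).S.obj ⟶ c'.S.obj := (c.compare c').hom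
  obtain ⟨k, hk, hk'⟩ : ∃ k : H.obj (cosyzygy X).J ⟶ c'.J,
      H.map (cosyzygy X).ι ≫ k = c'.ι ∧ H.map (cosyzygy X).π ≫ s = k ≫ c'.π := by
    obtain ⟨k, hk, hk'⟩ := c.compare_induces c'
    exact ⟨k, hk.trans (Category.id_comp _), hk'⟩
  obtain ⟨h₁, h₂, h₃⟩ := h.exact f.hom g.hom Z.property hf hfg hg
  refine StableGProj.IsStandard.mk (h.gprojFunctor.map f) (h.gprojFunctor.map g) h₁ h₂ h₃
    (H.map e ≫ k) (h.gprojFunctor.map w ≫ c.compare c') ?_ ?_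
  · change H.map f.hom ≫ H.map e ≫ k = c'.ι
    rw [← Functor.map_comp_assoc, he, hk]
  · change H.map g.hom ≫ H.map w.hom ≫ s = (H.map e ≫ k) ≫ c'.π
    rw [← Functor.map_comp_assoc, hw, Functor.map_comp_assoc, hk', Category.assoc]

theorem map_distinguished (h : IsStablyExact H)
    {t : SuspTriangle (TriangleData.susp (C := StableGProj Λ))}
    (ht : t ∈ TriangleData.distinguished) :
    t.map (T' := TriangleData.susp) h.stableFunctor h.commSusp ∈ TriangleData.distinguished := by
  obtain ⟨s, hs, hts⟩ := ht
  exact ⟨_, h.isStandard_map hs, hts.map _ _⟩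

theorem stableFunctor_additive (h : IsStablyExact H) : h.stableFunctor.Additive where
  map_add {X Y f g} := by
    obtain ⟨f, rfl⟩ := (CategoryTheory.Quotient.functor (stableRel Λ)).map_surjective f
    obtain ⟨g, rfl⟩ := (CategoryTheory.Quotient.functor (stableRel Λ)).map_surjective g
    have hadd : h.gprojFunctor.map (f + g) = h.gprojFunctor.map f + h.gprojFunctor.map g :=
      ObjectProperty.hom_ext _ (H.map_add (f := f.hom) (g := g.hom))
    exact (congrArg h.stableFunctor.map ((StableGProj.proj Λ).map_add (f := f) (g := g)).symm).trans
      ((congrArg (StableGProj.proj A).map hadd).trans (StableGProj.proj A).map_add)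

theorem stableFunctor_linear (K : Type u) [Field K] [Algebra K Λ] [Algebra K A] [H.Linear K]
    (h : IsStablyExact H) : h.stableFunctor.Linear K where
  map_smul {X Y} f r := by
    obtain ⟨f, rfl⟩ := (CategoryTheory.Quotient.functor (stableRel Λ)).map_surjective f
    have hsmul : h.gprojFunctor.map (r • f) = r • h.gprojFunctor.map f :=
      ObjectProperty.hom_ext _ (CategoryTheory.Functor.map_smul H r f.hom)
    exact congrArg (StableGProj.proj A).map hsmul

theorem stableFunctor_map_eq_iff (h : IsStablyExact H) {X Y : GProj Λ} (f g : X ⟶ Y) :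
    h.stableFunctor.map ((StableGProj.proj Λ).map f) =
        h.stableFunctor.map ((StableGProj.proj Λ).map g) ↔
      FactorsThroughProjective (H.map (f.hom - g.hom)) := by
  rw [H.map_sub]
  exact CategoryTheory.Quotient.functor_map_eq_iff (stableRel A) _ _

/-- The triangle equivalence given by a stably exact functor which is a stable equivalence. -/
def triangleEquivalence (K : Type u) [Field K] [Algebra K Λ] [Algebra K A] [H.Linear K]
    (h : IsStablyExact H) [h.stableFunctor.IsEquivalence] :
    TriangleEquivalence K (StableGProj Λ) (StableGProj A) where
  equiv := h.stableFunctor.asEquivalence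
  additive := h.stableFunctor_additive
  linear := h.stableFunctor_linear K
  commSusp := h.commSusp
  map_distinguished _ := h.map_distinguished

/-- The triangle equivalence onto a product given by two stably exact functors. -/
def prodTriangleEquivalence (K : Type u) {A' : Type u} [Ring A'] [Field K] [Algebra K Λ]
    [Algebra K A] [Algebra K A'] {H' : ModuleCat.{u} Λ ⥤ ModuleCat.{u} A'} [H'.Additive]
    [H.Linear K] [H'.Linear K] (h : IsStablyExact H) (h' : IsStablyExact H')
    [(h.stableFunctor.prod' h'.stableFunctor).IsEquivalence] :
    TriangleEquivalence K (StableGProj Λ) (StableGProj A × StableGProj A') where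
  equiv := (h.stableFunctor.prod' h'.stableFunctor).asEquivalence
  additive := ⟨Prod.ext h.stableFunctor_additive.map_add h'.stableFunctor_additive.map_add⟩
  linear := ⟨fun f r => Prod.ext ((h.stableFunctor_linear K).map_smul f r)
    ((h'.stableFunctor_linear K).map_smul f r)⟩
  commSusp := NatIso.ofComponents
    (fun X => Iso.prod (h.commSusp.app X) (h'.commSusp.app X))
    fun f => Prod.ext (h.commSusp.hom.naturality f) (h'.commSusp.hom.naturality f)
  map_distinguished _ ht := ⟨h.map_distinguished ht, h'.map_distinguished ht⟩

end IsStablyExact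

namespace TriangleEquivalence

variable {K : Type*} [Semiring K] {C D E : Type*} [Category* C] [Category* D] [Category* E]
  [Preadditive C] [Preadditive D] [Preadditive E] [Linear K C] [Linear K D] [Linear K E]
  [TriangleData C] [TriangleData D] [TriangleData E]

/-- The composition of triangle equivalences. -/
def trans (F : TriangleEquivalence K C D) (G : TriangleEquivalence K D E) :
    TriangleEquivalence K C E where
  equiv := F.equiv.trans G.equiv
  additive := by
    have := F.additive
    have := G.additive
    exact inferInstanceAs (F.equiv.functor ⋙ G.equiv.functor).Additive
  linear := by
    have := F.linear
    have := G.linear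
    exact inferInstanceAs ((F.equiv.functor ⋙ G.equiv.functor).Linear K)
  commSusp := SuspTriangle.compCommIso F.commSusp G.commSusp
  map_distinguished t ht :=
    (congrArg (· ∈ TriangleData.distinguished) (SuspTriangle.map_map F.commSusp G.commSusp t)).mp
      (G.map_distinguished _ (F.map_distinguished t ht))

end TriangleEquivalence

/-! ## Reduction along a surjection -/

theorem exists_semilinear_lift {R A P M N : Type*} [Ring R] [Ring A] {τ : R →+* A}
    [AddCommGroup P] [Module R P] [AddCommGroup M] [Module A M] [AddCommGroup N] [Module A N]
    [Module.Projective R P] {g : N →ₗ[A] M} (hg : Function.Surjective g) (h : P →ₛₗ[τ] M) :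
    ∃ k : P →ₛₗ[τ] N, ∀ x, g (k x) = h x := by
  let := Module.compHom M τ
  let := Module.compHom N τ
  let g' : N →ₗ[R] M := { g with map_smul' := fun r x => g.map_smul (τ r) x }
  let h' : P →ₗ[R] M := { h with map_smul' := h.map_smulₛₗ }
  obtain ⟨k, hk⟩ := Module.projective_lifting_property g' h' hg
  exact ⟨{ k with map_smul' := k.map_smul }, LinearMap.congr_fun hk⟩

section Reduction

variable {R A : Type u} [Ring R] [Ring A] (σ : R →+* A) [RingHomSurjective σ]

/-- The reduction `A ⊗ X` of an `R`-module `X` along a surjection `σ : R → A`, realized as the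
quotient of `X` by the submodule `(ker σ) X`. -/
def Reduction (X : Type u) [AddCommGroup X] [Module R X] : Type u :=
  X ⧸ (RingHom.ker σ • ⊤ : Submodule R X)

namespace Reduction

variable {X Y Z U : Type u} [AddCommGroup X] [Module R X] [AddCommGroup Y] [Module R Y]
  [AddCommGroup Z] [Module R Z] [AddCommGroup U] [Module A U]

instance : AddCommGroup (Reduction σ X) :=
  inferInstanceAs (AddCommGroup (X ⧸ (RingHom.ker σ • ⊤ : Submodule R X)))

instance : Module A (Reduction σ X) :=
  Module.compHom (X ⧸ (RingHom.ker σ • ⊤ : Submodule R X))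
    (RingHom.quotientKerEquivOfSurjective σ.surjective).symm.toRingHom

/-- The projection to the reduction. -/
def mk : X →ₛₗ[σ] Reduction σ X where
  toFun x := Submodule.Quotient.mk x
  map_add' _ _ := rfl
  map_smul' r x := by
    change _ = (RingHom.quotientKerEquivOfSurjective σ.surjective).symm (σ r) •
      (Submodule.Quotient.mk x : X ⧸ (RingHom.ker σ • ⊤ : Submodule R X))
    have : (RingHom.quotientKerEquivOfSurjective σ.surjective).symm (σ r) =
        Ideal.Quotient.mk _ r := by
      rw [RingEquiv.symm_apply_eq]
      rfl
    rw [this]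
    rfl

theorem mk_surjective : Function.Surjective (mk σ (X := X)) := Submodule.Quotient.mk_surjective _

variable {σ}

theorem mk_eq_zero_iff {x : X} : mk σ x = 0 ↔ x ∈ (RingHom.ker σ • ⊤ : Submodule R X) :=
  Submodule.Quotient.mk_eq_zero _

theorem hom_ext {g h : Reduction σ X →ₗ[A] U} (H : ∀ x, g (mk σ x) = h (mk σ x)) : g = h :=
  LinearMap.ext ((mk_surjective σ).forall.2 H)

theorem eq_zero_of_mk_eq_zero (g : X →ₛₗ[σ] U) {x : X} (hx : mk σ x = 0) : g x = 0 := by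
  rw [mk_eq_zero_iff] at hx
  induction hx using Submodule.smul_induction_on' with
  | smul r hr x _ => rw [map_smulₛₗ, RingHom.mem_ker.1 hr, zero_smul]
  | add x _ y _ hx hy => rw [map_add, hx, hy, add_zero]

/-- Semilinear maps factor through the reduction. -/
def lift (g : X →ₛₗ[σ] U) : Reduction σ X →ₗ[A] U where
  toFun := QuotientAddGroup.lift (RingHom.ker σ • ⊤ : Submodule R X).toAddSubgroup
    g.toAddMonoidHom fun _ hx => eq_zero_of_mk_eq_zero g (mk_eq_zero_iff.2 hx)
  map_add' _ _ := map_add _ _ _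
  map_smul' a y := by
    obtain ⟨r, rfl⟩ := σ.surjective a
    obtain ⟨x, rfl⟩ := mk_surjective σ y
    rw [← map_smulₛₗ]
    exact g.map_smulₛₗ r x

variable (σ) in
/-- The map on reductions. -/
def map (f : X →ₗ[R] Y) : Reduction σ X →ₗ[A] Reduction σ Y := lift ((mk σ).comp f)

@[simp]
theorem map_mk (f : X →ₗ[R] Y) (x : X) : map σ f (mk σ x) = mk σ (f x) := rfl

theorem map_surjective {f : X →ₗ[R] Y} (hf : Function.Surjective f) :
    Function.Surjective (map σ f) :=
  (mk_surjective σ).forall.2 fun y => (hf y).imp' (mk σ) fun _ hx => congrArg (mk σ) hx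

variable (σ)

variable (X) in
theorem finite [Module.Finite R X] : Module.Finite A (Reduction σ X) :=
  Module.Finite.of_surjective (mk σ) (mk_surjective σ)

variable (X) in
theorem projective [Module.Projective R X] : Module.Projective A (Reduction σ X) := by
  refine Module.Projective.of_lifting_property'' fun p hp => ?_
  obtain ⟨k, hk⟩ := exists_semilinear_lift hp (mk σ (X := X))
  exact ⟨lift k, hom_ext hk⟩

/-- Reduction as a functor. -/
def functor : ModuleCat.{u} R ⥤ ModuleCat.{u} A where
  obj X := ModuleCat.of A (Reduction σ X)
  map f := ModuleCat.ofHom (map σ f.hom)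
  map_id _ := ModuleCat.hom_ext (hom_ext fun _ => rfl)
  map_comp _ _ := ModuleCat.hom_ext (hom_ext fun _ => rfl)

instance : (functor σ).Additive where
  map_add := ModuleCat.hom_ext (hom_ext fun _ => map_add (mk σ) _ _)

theorem functor_linear (K : Type u) [Field K] [Algebra K R] [Algebra K A]
    (hσ : ∀ c, σ (algebraMap K R c) = algebraMap K A c) : (functor σ).Linear K where
  map_smul {X Y} f c := ModuleCat.hom_ext <| hom_ext fun x => by
    change mk σ (algebraMap K R c • f.hom x) = algebraMap K A c • mk σ (f.hom x)
    rw [map_smulₛₗ, hσ]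

/-- The functor `X ↦ A ⊗ X` is exact on sequences which continue into a projective module. -/
def IsExactBelowProjectives : Prop :=
  ∀ ⦃X Y Z Q : Type u⦄ [AddCommGroup X] [Module R X] [AddCommGroup Y] [Module R Y]
    [AddCommGroup Z] [Module R Z] [AddCommGroup Q] [Module R Q] [Module.Projective R Q]
    (f : X →ₗ[R] Y) (g : Y →ₗ[R] Z) (h : Z →ₗ[R] Q), Function.Exact f g → Function.Exact g h →
      Function.Exact (map σ f) (map σ g)

variable {σ}

theorem IsExactBelowProjectives.map_injective (hσ : IsExactBelowProjectives σ) {Q : Type u}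
    [AddCommGroup Q] [Module R Q] [Module.Projective R Q] {f : X →ₗ[R] Y} {g : Y →ₗ[R] Q}
    (hf : Function.Injective f) (hfg : Function.Exact f g) : Function.Injective (map σ f) := by
  refine (injective_iff_map_eq_zero _).2 fun x hx => ?_
  obtain ⟨y, rfl⟩ := (hσ (0 : PUnit.{u + 1} →ₗ[R] X) f g
    ((LinearMap.exact_zero_iff_injective PUnit.{u + 1} f).2 hf) hfg x).1 hx
  obtain ⟨y, rfl⟩ := mk_surjective σ y
  exact map_zero (mk σ)

/-- The image of an acyclic complex. -/
def IsExactBelowProjectives.mapComplex (hσ : IsExactBelowProjectives σ) (P : AcyclicComplex R) :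
    AcyclicComplex A where
  X n := (functor σ).obj (P.X n)
  d n := map σ (P.d n)
  finite n := have := P.finite n; Reduction.finite σ _
  projective n := have := P.projective n; Reduction.projective σ _
  exact n := have := P.projective (n + 1 + 1 + 1); hσ _ _ _ (P.exact n) (P.exact (n + 1))

theorem isHomExact_mapComplex (hσ : IsExactBelowProjectives σ)
    [Module.Projective R (RingHom.ker σ)] {P : AcyclicComplex R} (hP : P.IsHomExact R) :
    (hσ.mapComplex P).IsHomExact A := by
  let := Module.compHom A σ
  let p : R →ₗ[R] A := { σ with map_smul' := map_mul σ }
  have hPA : P.IsHomExact A := .of_exact (i := (RingHom.ker σ).subtype) (p := p)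
    Subtype.val_injective (LinearMap.exact_subtype_ker_map p) σ.surjective hP.of_projective hP
  intro n g hg
  let g' : P.X (n + 1) →ₗ[R] A :=
    { g.toAddMonoidHom.comp (mk σ).toAddMonoidHom with
      map_smul' := fun r x => (congrArg g ((mk σ).map_smulₛₗ r x)).trans (g.map_smul _ _) }
  obtain ⟨k, hk⟩ := hPA n g' (LinearMap.ext fun x => LinearMap.congr_fun hg (mk σ x))
  exact ⟨lift { k with map_smul' := k.map_smul }, hom_ext (LinearMap.congr_fun hk)⟩

theorem isStablyExact (hσ : IsExactBelowProjectives σ) [Module.Projective R (RingHom.ker σ)] :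
    IsStablyExact (functor σ) where
  gproj G hG := by
    obtain ⟨P, i, hP, hi, hid⟩ := hG.exists_acyclicComplex rfl
    have := P.projective
    exact AcyclicComplex.isGorensteinProjective_of_exact (isHomExact_mapComplex hσ hP)
      (hσ.map_injective hi hid) (hσ i _ _ hid (P.exact 0))
  finite P _ := finite σ P
  projective P _ := projective σ P
  exact {X Y Z} f g hZ hf hfg hg := by
    obtain ⟨P, i, -, hi, -⟩ := hZ.exists_acyclicComplex rfl
    have := P.projective 0
    refine ⟨hσ.map_injective (g := i ∘ₗ g.hom) hf ?_,
      hσ f.hom g.hom (0 : Z →ₗ[R] PUnit.{u + 1}) hfg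
        ((LinearMap.exact_zero_iff_surjective PUnit.{u + 1} g.hom).2 hg),
      map_surjective hg⟩
    exact hfg.comp_injective _ hi (map_zero i)

end Reduction

end Reduction

theorem exists_algHom_of_surjective {K S T A : Type u} [Field K] [Ring S] [Ring T] [Ring A]
    [Algebra K S] [Algebra K T] [Algebra K A] {π : S →ₐ[K] T} (hπ : Function.Surjective π)
    {φ : S →ₐ[K] A} (h : ∀ s, π s = 0 → φ s = 0) :
    ∃ ψ : T →ₐ[K] A, ∀ s, ψ (π s) = φ s := by
  have hle : RingHom.ker (π : S →+* T) ≤ RingHom.ker (φ : S →+* A) := h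
  let ψ : T →+* A := (π : S →+* T).liftOfSurjective hπ ⟨(φ : S →+* A), hle⟩
  have hψ : ∀ s, ψ (π s) = φ s :=
    (π : S →+* T).liftOfSurjective_comp_apply hπ ⟨(φ : S →+* A), hle⟩
  exact ⟨{ ψ with
    commutes' c := (congrArg ψ (π.commutes c)).symm.trans ((hψ _).trans (φ.commutes c)) }, hψ⟩

/-! ## Modules over an algebra with an adjoined arrow -/

section Corner

variable (K : Type u) [Field K] {R R' : Type u} [Ring R] [Ring R'] [Algebra K R]
  [Algebra K R'] (ε : R) (X : Type u) {Y Z : Type u} [AddCommGroup X] [Module R X]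
  [AddCommGroup Y] [Module R Y] [AddCommGroup Z] [Module R Z]

/-- The corner `ε X` of a module `X` over a `K`-algebra, as the set of the elements fixed by the
idempotent `ε`. -/
def Corner : AddSubgroup X where
  carrier := {x | ε • x = x}
  zero_mem' := smul_zero ε
  add_mem' hx hy := (smul_add ε _ _).trans (congrArg₂ _ hx hy)
  neg_mem' hx := (smul_neg ε _).trans (congrArg _ hx)

namespace Corner

instance : SMul K (Corner ε X) where
  smul c x := ⟨algebraMap K R c • x, by
    have hx : ε • (x : X) = x := x.2
    change ε • algebraMap K R c • (x : X) = algebraMap K R c • x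
    rw [← mul_smul, ← Algebra.commutes, mul_smul, hx]⟩

instance : Module K (Corner ε X) :=
  let := Module.compHom X (algebraMap K R)
  Subtype.val_injective.module K (Corner ε X).subtype fun _ _ => rfl

variable {ε X}

theorem smul_coe (x : Corner ε X) : ε • (x : X) = x := x.2

theorem smul_mem (hε : ε * ε = ε) (x : X) : ε • x ∈ Corner ε X := by
  change ε • ε • x = ε • x
  rw [← mul_smul, hε]

variable {K}

/-- A homomorphism which is semilinear along a homomorphism of algebras restricts to corners. -/
def map {ε' : R'} {Y : Type u} [AddCommGroup Y] [Module R' Y] {τ : R →ₐ[K] R'} (hτ : τ ε = ε')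
    (g : X →ₛₗ[(τ : R →+* R')] Y) : Corner ε X →ₗ[K] Corner ε' Y where
  toFun x := ⟨g x, by
    change ε' • g x = g x
    rw [← hτ]
    exact (g.map_smulₛₗ ε x).symm.trans (congrArg g (smul_coe x))⟩
  map_add' x y := Subtype.ext (map_add g _ _)
  map_smul' c x := Subtype.ext <|
    (g.map_smulₛₗ _ _).trans (congrArg (· • g (x : X)) (τ.commutes c))

variable (K ε) in
/-- A linear map restricts to corners. -/
abbrev lmap (g : X →ₗ[R] Y) : Corner ε X →ₗ[K] Corner ε Y := map (τ := AlgHom.id K R) rfl g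

theorem map_injective {ε' : R'} {Y : Type u} [AddCommGroup Y] [Module R' Y] {τ : R →ₐ[K] R'}
    {hτ : τ ε = ε'} {g : X →ₛₗ[(τ : R →+* R')] Y} (hg : ∀ x, ε • x = x → g x = 0 → x = 0) :
    Function.Injective (map hτ g) :=
  (injective_iff_map_eq_zero _).2 fun x hx =>
    Subtype.ext (hg x x.2 (congrArg Subtype.val hx))

theorem lmap_surjective (hε : ε * ε = ε) {g : X →ₗ[R] Y} (hg : Function.Surjective g) :
    Function.Surjective (lmap K ε g) := fun y => by
  obtain ⟨x, hx⟩ := hg y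
  exact ⟨⟨ε • x, smul_mem hε x⟩, Subtype.ext <| by
    change g (ε • x) = y
    rw [map_smul, hx, smul_coe]⟩

theorem lmap_exact (hε : ε * ε = ε) {f : X →ₗ[R] Y} {g : Y →ₗ[R] Z} (h : Function.Exact f g) :
    Function.Exact (lmap K ε f) (lmap K ε g) := fun y => by
  refine ⟨fun hy => ?_, ?_⟩
  · obtain ⟨x, hx⟩ := (h y).1 (congrArg Subtype.val hy)
    exact ⟨⟨ε • x, smul_mem hε x⟩, Subtype.ext <| by
      change f (ε • x) = y
      rw [map_smul, hx, smul_coe]⟩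
  · rintro ⟨x, rfl⟩
    exact Subtype.ext (h.apply_apply_eq_zero x)

end Corner

end Corner

/-- The algebra `Λ` is obtained from `S` by adjoining an arrow `a` with `e a f = a` to elements
`e` and `f` with `e² = e`, `f² = f` and `f S e = 0`, so that `Λ = S ⊕ S a S`. -/
structure ArrowExtension (K S Λ : Type u) [Field K] [Ring S] [Ring Λ] [Algebra K S]
    [Algebra K Λ] where
  ι : S →ₐ[K] Λ
  arrow : Λ
  e : S
  f : S
  e_mul_e : e * e = e
  f_mul_f : f * f = f
  f_mul_mul_e : ∀ s, f * s * e = 0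
  e_mul_arrow : ι e * arrow = arrow
  arrow_mul_f : arrow * ι f = arrow
  adjoin_eq_top : Algebra.adjoin K (Set.range ι ∪ {arrow}) = ⊤
  exists_lift : ∀ {A : Type u} [Ring A] [Algebra K A] (φ : S →ₐ[K] A) (a : A), φ e * a = a →
    a * φ f = a → ∃ ρ : Λ →ₐ[K] A, (∀ s, ρ (ι s) = φ s) ∧ ρ arrow = a

namespace ArrowExtension

variable {K S Λ : Type u} [Field K] [Ring S] [Ring Λ] [Algebra K S] [Algebra K Λ]
  (E : ArrowExtension K S Λ)

theorem induction {p : Λ → Prop} (incl : ∀ s, p (E.ι s)) (arrow : p E.arrow)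
    (add : ∀ l m, p l → p m → p (l + m)) (mul : ∀ l m, p l → p m → p (l * m)) (l : Λ) : p l := by
  have hl : l ∈ Algebra.adjoin K (Set.range E.ι ∪ {E.arrow}) := E.adjoin_eq_top ▸ trivial
  induction hl using Algebra.adjoin_induction with
  | mem l hl =>
    obtain ⟨s, rfl⟩ | rfl := hl
    exacts [incl s, arrow]
  | algebraMap c => exact E.ι.commutes c ▸ incl _
  | add l m _ _ hl hm => exact add l m hl hm
  | mul l m _ _ hl hm => exact mul l m hl hm

theorem exists_retraction : ∃ ρ : Λ →ₐ[K] S, (∀ s, ρ (E.ι s) = s) ∧ ρ E.arrow = 0 :=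
  E.exists_lift (AlgHom.id K S) 0 (mul_zero _) (zero_mul _)

/-- The homomorphism `Λ → S` which is the identity on `S` and kills the arrow. -/
def ret : Λ →ₐ[K] S := E.exists_retraction.choose

@[simp]
theorem ret_ι (s : S) : E.ret (E.ι s) = s := E.exists_retraction.choose_spec.1 s

@[simp]
theorem ret_arrow : E.ret E.arrow = 0 := E.exists_retraction.choose_spec.2

instance : RingHomSurjective (E.ret : Λ →+* S) := ⟨fun s => ⟨E.ι s, E.ret_ι s⟩⟩

/-- The left ideal `S e`. -/
def Se : Ideal S := Ideal.span {E.e}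

theorem mul_e (s : E.Se) : (s : S) * E.e = s := by
  obtain ⟨t, ht⟩ := Ideal.mem_span_singleton'.1 s.2
  rw [← ht, mul_assoc, E.e_mul_e]

theorem e_mem : E.e ∈ E.Se := Ideal.mem_span_singleton_self _

instance : Module.Projective S E.Se :=
  .of_split E.Se.subtype
    ((LinearMap.toSpanSingleton S S E.e).codRestrict E.Se fun s => E.Se.mul_mem_left s E.e_mem)
    (LinearMap.ext fun s => Subtype.ext (E.mul_e s))

section Bridge

variable {V W : Type u} [AddCommGroup V] [Module K V] [AddCommGroup W] [Module K W]
  {N N' : Type u} [AddCommGroup N] [Module Λ N] [AddCommGroup N'] [Module Λ N']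

/-- The generators `e ⊗ v` of `S e ⊗ V`. -/
def gen : V →ₗ[K] E.Se ⊗[K] V := TensorProduct.mk K E.Se V ⟨E.e, E.e_mem⟩

theorem smul_gen (s : E.Se) (v : V) : (s : S) • E.gen v = s ⊗ₜ v :=
  (TensorProduct.smul_tmul' _ _ _).trans (congrArg (· ⊗ₜ v) (Subtype.ext (E.mul_e s)))

theorem bridge_induction {p : E.Se ⊗[K] V → Prop} (smul_gen : ∀ (s : S) v, p (s • E.gen v))
    (add : ∀ m n, p m → p n → p (m + n)) (m : E.Se ⊗[K] V) : p m := by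
  have tmul (s : E.Se) (v : V) : p (s ⊗ₜ v) := E.smul_gen s v ▸ smul_gen s v
  induction m with
  | zero => simpa using tmul 0 0
  | tmul s v => exact tmul s v
  | add m n hm hn => exact add m n hm hn

theorem f_smul (m : E.Se ⊗[K] V) : E.f • m = 0 := by
  induction m with
  | zero => exact smul_zero _
  | tmul s v =>
    have hs : E.f • s = 0 := Subtype.ext <| by
      change E.f * s = 0
      rw [← E.mul_e, ← mul_assoc, E.f_mul_mul_e]
    rw [TensorProduct.smul_tmul', hs, TensorProduct.zero_tmul]
  | add m n hm hn => rw [smul_add, hm, hn, add_zero]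

/-- The `S`-linear map `S e ⊗ V → N` given by a `K`-linear map `V → e N`. -/
def bridgeLift (n : V →ₗ[K] Corner (E.ι E.e) N) : E.Se ⊗[K] V →ₛₗ[(E.ι : S →+* Λ)] N :=
  let g : E.Se ⊗[K] V →+ N := TensorProduct.liftAddHom
    { toFun s := (DistribSMul.toAddMonoidHom N (E.ι s)).comp
        ((Corner (E.ι E.e) N).subtype.comp n.toAddMonoidHom)
      map_zero' := by ext; simp
      map_add' s t := by ext; simp [add_smul] }
    fun c s v => by
      change E.ι (c • s : S) • (n v : N) = E.ι s • ((n (c • v) : Corner (E.ι E.e) N) : N)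
      rw [map_smul, map_smul, Algebra.smul_def, Algebra.commutes, mul_smul]
      rfl
  { g with
    map_smul' := fun s m => by
      change g (s • m) = E.ι s • g m
      induction m with
      | zero => simp
      | tmul t v =>
        change E.ι (s * t) • (n v : N) = E.ι s • E.ι t • (n v : N)
        rw [map_mul, mul_smul]
      | add m n hm hn => rw [smul_add, map_add, map_add, smul_add, hm, hn] }

@[simp]
theorem bridgeLift_gen (n : V →ₗ[K] Corner (E.ι E.e) N) (v : V) :
    E.bridgeLift n (E.gen v) = n v := Corner.smul_coe (n v)

theorem f_smul_bridgeLift (n : V →ₗ[K] Corner (E.ι E.e) N) (m : E.Se ⊗[K] V) :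
    E.ι E.f • E.bridgeLift n m = 0 := by
  refine ((E.bridgeLift n).map_smulₛₗ E.f m).symm.trans ?_
  rw [f_smul, map_zero]

theorem smul_bridgeLift (n : V →ₗ[K] Corner (E.ι E.e) N) (l : Λ) (m : E.Se ⊗[K] V) :
    l • E.bridgeLift n m = E.bridgeLift n (E.ret l • m) := by
  induction l using E.induction generalizing m with
  | incl s => simp
  | arrow => rw [← E.arrow_mul_f, mul_smul, f_smul_bridgeLift]; simp
  | add l l' h h' => rw [add_smul, h, h', map_add, add_smul, map_add]
  | mul l l' h h' => rw [mul_smul, h', h, map_mul, mul_smul]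

theorem map_bridgeLift (g : N →ₗ[Λ] N') (n : V →ₗ[K] Corner (E.ι E.e) N) (m : E.Se ⊗[K] V) :
    g (E.bridgeLift n m) = E.bridgeLift (Corner.lmap K _ g ∘ₗ n) m := by
  induction m using E.bridge_induction with
  | smul_gen s v =>
    rw [(E.bridgeLift _).map_smulₛₗ, (E.bridgeLift _).map_smulₛₗ, bridgeLift_gen, bridgeLift_gen,
      g.map_smul]
    rfl
  | add m m' h h' => rw [map_add, map_add, map_add, h, h']

/-- The map `S e ⊗ V → S e ⊗ W` given by a map `V → W`. -/
def bridgeMap (g : V →ₗ[K] W) : E.Se ⊗[K] V →ₗ[S] E.Se ⊗[K] W :=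
  TensorProduct.AlgebraTensorModule.lTensor S E.Se g

@[simp]
theorem bridgeMap_gen (g : V →ₗ[K] W) (v : V) : E.bridgeMap g (E.gen v) = E.gen (g v) := rfl

theorem bridgeLift_bridgeMap (n : W →ₗ[K] Corner (E.ι E.e) N) (g : V →ₗ[K] W)
    (m : E.Se ⊗[K] V) : E.bridgeLift n (E.bridgeMap g m) = E.bridgeLift (n ∘ₗ g) m := by
  induction m using E.bridge_induction with
  | smul_gen s v => simp only [map_smul, map_smulₛₗ, bridgeMap_gen, bridgeLift_gen,
      LinearMap.comp_apply]
  | add m m' h h' => rw [map_add, map_add, map_add, h, h']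

theorem bridgeMap_id (m : E.Se ⊗[K] V) : E.bridgeMap LinearMap.id m = m :=
  LinearMap.lTensor_id_apply E.Se V m

theorem bridgeMap_bridgeMap {V' : Type u} [AddCommGroup V'] [Module K V'] (g : V →ₗ[K] W)
    (h : W →ₗ[K] V') (m : E.Se ⊗[K] V) :
    E.bridgeMap h (E.bridgeMap g m) = E.bridgeMap (h ∘ₗ g) m :=
  (LinearMap.lTensor_comp_apply E.Se h g m).symm

theorem bridgeMap_injective {g : V →ₗ[K] W} (hg : Function.Injective g) :
    Function.Injective (E.bridgeMap g) :=
  Module.Flat.lTensor_preserves_injective_linearMap g hg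

theorem bridgeMap_surjective {g : V →ₗ[K] W} (hg : Function.Surjective g) :
    Function.Surjective (E.bridgeMap g) :=
  LinearMap.lTensor_surjective E.Se hg

theorem bridgeMap_exact {V' : Type u} [AddCommGroup V'] [Module K V'] {g : V →ₗ[K] W}
    {h : W →ₗ[K] V'} (hgh : Function.Exact g h) :
    Function.Exact (E.bridgeMap g) (E.bridgeMap h) :=
  Module.Flat.lTensor_exact E.Se hgh

end Bridge

section Action

variable (X : Type u) {Y Z : Type u} [AddCommGroup X] [Module Λ X] [AddCommGroup Y] [Module Λ Y]
  [AddCommGroup Z] [Module Λ Z]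

/-- The multiplication `f X → e X` by the arrow. -/
def arrowMap : Corner (E.ι E.f) X →ₗ[K] Corner (E.ι E.e) X where
  toFun x := ⟨E.arrow • x, by
    change E.ι E.e • E.arrow • (x : X) = E.arrow • (x : X)
    rw [← mul_smul, E.e_mul_arrow]⟩
  map_add' x y := Subtype.ext (smul_add _ _ _)
  map_smul' c x := Subtype.ext <| by
    change E.arrow • algebraMap K Λ c • (x : X) = algebraMap K Λ c • E.arrow • (x : X)
    rw [← mul_smul, ← mul_smul, Algebra.commutes]

/-- The action `S e ⊗ f X → X`, `s ⊗ x ↦ s a x` of the arrow. -/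
def bridge : E.Se ⊗[K] Corner (E.ι E.f) X →ₛₗ[(E.ι : S →+* Λ)] X := E.bridgeLift (E.arrowMap X)

variable {X}

@[simp]
theorem bridge_gen (x : Corner (E.ι E.f) X) : E.bridge X (E.gen x) = E.arrow • (x : X) :=
  E.bridgeLift_gen _ _

theorem map_bridge (g : X →ₗ[Λ] Y) (m : E.Se ⊗[K] Corner (E.ι E.f) X) :
    g (E.bridge X m) = E.bridge Y (E.bridgeMap (Corner.lmap K _ g) m) := by
  have h : Corner.lmap K _ g ∘ₗ E.arrowMap X = E.arrowMap Y ∘ₗ Corner.lmap K _ g :=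
    LinearMap.ext fun x => Subtype.ext (g.map_smul E.arrow x)
  rw [bridge, bridge, map_bridgeLift, bridgeLift_bridgeMap, h]

theorem mk_bridge (m : E.Se ⊗[K] Corner (E.ι E.f) X) :
    Reduction.mk (E.ret : Λ →+* S) (E.bridge X m) = 0 := by
  induction m using E.bridge_induction with
  | smul_gen s x => simp [map_smulₛₗ]
  | add m n hm hn => rw [map_add, map_add, hm, hn, add_zero]

theorem exists_bridge_eq_smul (l : Λ) (x : X) :
    ∃ m, E.bridge X m = l • x - E.ι (E.ret l) • x := by
  induction l using E.induction generalizing x with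
  | incl s => exact ⟨0, by simp⟩
  | arrow =>
    refine ⟨E.gen ⟨E.ι E.f • x, ?_⟩, ?_⟩
    · exact Corner.smul_mem (by rw [← map_mul, E.f_mul_f]) x
    · rw [bridge_gen]
      simp [← mul_smul, E.arrow_mul_f]
  | add l l' h h' =>
    obtain ⟨⟨m, hm⟩, m', hm'⟩ := And.intro (h x) (h' x)
    exact ⟨m + m', by simp only [map_add, hm, hm', add_smul]; abel⟩
  | mul l l' h h' =>
    obtain ⟨⟨m, hm⟩, m', hm'⟩ := And.intro (h (l' • x)) (h' x)
    exact ⟨m + E.ret l • m', by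
      simp only [map_add, map_smulₛₗ, hm, hm', map_mul, mul_smul, smul_sub]
      exact sub_add_sub_cancel _ _ _⟩

theorem mk_eq_zero_iff {x : X} : Reduction.mk (E.ret : Λ →+* S) x = 0 ↔ ∃ m, E.bridge X m = x := by
  refine ⟨fun hx => ?_, by rintro ⟨m, rfl⟩; exact E.mk_bridge m⟩
  rw [Reduction.mk_eq_zero_iff] at hx
  induction hx using Submodule.smul_induction_on' with
  | smul l hl x _ =>
    have hl : E.ret l = 0 := hl
    simpa [hl] using E.exists_bridge_eq_smul l x
  | add x _ y _ hx hy =>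
    obtain ⟨⟨m, rfl⟩, n, rfl⟩ := And.intro hx hy
    exact ⟨m + n, map_add _ _ _⟩

theorem f_smul_eq_zero {x : X} (hx : Reduction.mk (E.ret : Λ →+* S) x = 0) :
    E.ι E.f • x = 0 := by
  obtain ⟨m, rfl⟩ := E.mk_eq_zero_iff.1 hx
  exact E.f_smul_bridgeLift _ m

end Action

section Ind

variable (U : Type u) {V W : Type u} [AddCommGroup U] [Module S U] [AddCommGroup V] [Module S V]
  [AddCommGroup W] [Module S W] {X : Type u} [AddCommGroup X] [Module Λ X]

/-- The induced module `Λ ⊗ U`, realized as `U ⊕ (S e ⊗ f U)`. -/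
def Ind : Type u := U × (E.Se ⊗[K] Corner E.f U)

instance : AddCommGroup (E.Ind U) :=
  inferInstanceAs (AddCommGroup (U × (E.Se ⊗[K] Corner E.f U)))

variable {U}

/-- The projection to the corner `f U`. -/
def toCorner (u : U) : Corner E.f U := ⟨E.f • u, Corner.smul_mem E.f_mul_f u⟩

theorem toCorner_coe (u : Corner E.f U) : E.toCorner (u : U) = u := Subtype.ext (Corner.smul_coe u)

theorem toCorner_f_smul (u : U) : E.toCorner (E.f • u) = E.toCorner u :=
  E.toCorner_coe (E.toCorner u)

variable (U)

theorem exists_action : ∃ ρ : Λ →+* AddMonoid.End (U × (E.Se ⊗[K] Corner E.f U)),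
    (∀ s z, ρ (E.ι s) z = (s • z.1, s • z.2)) ∧
      ∀ z, ρ E.arrow z = (0, E.gen (E.toCorner z.1)) := by
  let := Module.compHom U (algebraMap K S)
  have : IsScalarTower K S U := .of_algebraMap_smul fun _ _ => rfl
  let p : U →ₗ[K] Corner E.f U :=
    { toFun := E.toCorner
      map_add' := fun u v => Subtype.ext (smul_add _ _ _)
      map_smul' := fun c u => Subtype.ext <| by
        change E.f • algebraMap K S c • u = algebraMap K S c • E.f • u
        rw [← mul_smul, ← mul_smul, Algebra.commutes] }
  let a : Module.End K (U × (E.Se ⊗[K] Corner E.f U)) :=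
    LinearMap.inr K U _ ∘ₗ E.gen ∘ₗ p ∘ₗ LinearMap.fst K U _
  have e_smul_gen (x : Corner E.f U) : E.e • E.gen x = E.gen x := E.smul_gen ⟨E.e, E.e_mem⟩ x
  obtain ⟨ρ, h, h'⟩ := E.exists_lift (Algebra.lsmul K K (U × (E.Se ⊗[K] Corner E.f U))) a
    (LinearMap.ext fun z => Prod.ext (smul_zero _) (e_smul_gen _))
    (LinearMap.ext fun z => congrArg (fun x => (0, E.gen x)) (E.toCorner_f_smul z.1))
  exact ⟨(Module.toAddMonoidEnd (Module.End K (U × (E.Se ⊗[K] Corner E.f U))) _).comp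
    (ρ : Λ →+* _), fun s => LinearMap.congr_fun (h s), LinearMap.congr_fun h'⟩

instance : Module Λ (E.Ind U) :=
  Module.compHom (U × (E.Se ⊗[K] Corner E.f U)) (E.exists_action U).choose

theorem ι_smul (s : S) (z : E.Ind U) : E.ι s • z = (s • z.1, s • z.2) :=
  (E.exists_action U).choose_spec.1 s z

theorem arrow_smul (z : E.Ind U) : E.arrow • z = (0, E.gen (E.toCorner z.1)) :=
  (E.exists_action U).choose_spec.2 z

/-- The inclusion of a module into the induced module. -/
def incl : U →ₛₗ[(E.ι : S →+* Λ)] E.Ind U where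
  toFun u := (u, 0)
  map_add' _ _ := Prod.ext rfl (add_zero _).symm
  map_smul' s u := ((E.ι_smul U s (u, 0)).trans (Prod.ext rfl (smul_zero s))).symm

/-- The projection from the induced module. -/
def proj : E.Ind U →ₛₗ[(E.ret : Λ →+* S)] U where
  toFun z := z.1
  map_add' _ _ := rfl
  map_smul' l z := by
    change (l • z).1 = E.ret l • z.1
    induction l using E.induction generalizing z with
    | incl s => rw [ι_smul, ret_ι]
    | arrow => rw [arrow_smul, ret_arrow, zero_smul]
    | add l l' h h' => rw [add_smul, map_add, add_smul, ← h, ← h']; rfl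
    | mul l l' h h' => rw [mul_smul, h, h', map_mul, mul_smul]

variable {U}

theorem bridge_ind (m : E.Se ⊗[K] Corner (E.ι E.f) (E.Ind U)) :
    E.bridge (E.Ind U) m = (0, E.bridgeMap (Corner.map (E.ret_ι E.f) (E.proj U)) m) := by
  induction m using E.bridge_induction with
  | smul_gen s z =>
    rw [map_smulₛₗ, bridge_gen, arrow_smul]
    refine (E.ι_smul U s _).trans (Prod.ext (smul_zero s) ?_)
    exact congrArg (fun u => s • E.gen u) (E.toCorner_coe (Corner.map (E.ret_ι E.f) (E.proj U) z))
  | add m n hm hn => rw [map_add, hm, hn, map_add]; exact Prod.ext (add_zero _) rfl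

theorem bridge_ind_injective : Function.Injective (E.bridge (E.Ind U)) := by
  refine (injective_iff_map_eq_zero _).2 fun m hm => ?_
  rw [bridge_ind] at hm
  refine E.bridgeMap_injective (Corner.map_injective fun z hz hz' => ?_)
    ((congrArg Prod.snd hm).trans (map_zero _).symm)
  have hz' : z.1 = 0 := hz'
  rw [ι_smul, E.f_smul] at hz
  exact hz.symm.trans (Prod.ext ((congrArg _ hz').trans (smul_zero _)) rfl)

theorem eq_incl_add_bridge (z : E.Ind U) :
    E.incl U z.1 + E.bridge _ (E.bridgeMap (Corner.map rfl (E.incl U)) z.2) = z := by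
  rw [bridge_ind, bridgeMap_bridgeMap]
  exact Prod.ext (add_zero _) ((zero_add _).trans (E.bridgeMap_id z.2))

theorem ind_hom_ext {g h : E.Ind U →ₗ[Λ] X} (H : ∀ u, g (E.incl U u) = h (E.incl U u)) :
    g = h := by
  ext z
  rw [← E.eq_incl_add_bridge z, map_add, map_add, H, map_bridge, map_bridge, bridgeMap_bridgeMap,
    bridgeMap_bridgeMap]
  exact congrArg (fun n => h _ + E.bridge X (E.bridgeMap n z.2))
    (LinearMap.ext fun u => Subtype.ext (H u))

/-- The homomorphism on the induced module given by a map of `S`-modules. -/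
def lift (t : U →ₛₗ[(E.ι : S →+* Λ)] X) : E.Ind U →ₗ[Λ] X where
  toFun z := t z.1 + E.bridge X (E.bridgeMap (Corner.map rfl t) z.2)
  map_add' z w := by
    change t (z.1 + w.1) + E.bridge X (E.bridgeMap _ (z.2 + w.2)) = _
    simp only [map_add]
    exact add_add_add_comm _ _ _ _
  map_smul' l z := by
    change _ = l • _
    induction l using E.induction generalizing z with
    | incl s =>
      rw [ι_smul, smul_add, LinearMap.map_smul, t.map_smulₛₗ, (E.bridge X).map_smulₛₗ]
      rfl
    | arrow =>
      have h : E.arrow • E.bridge X (E.bridgeMap (Corner.map rfl t) z.2) = 0 := by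
        rw [bridge, smul_bridgeLift, ret_arrow, zero_smul, map_zero]
      rw [arrow_smul, map_zero, zero_add, bridgeMap_gen, bridge_gen, smul_add, h, add_zero]
      change E.arrow • t (E.f • z.1) = _
      rw [map_smulₛₗ, ← mul_smul]
      exact congrArg (· • t z.1) E.arrow_mul_f
    | add l l' h h' =>
      rw [add_smul, add_smul, ← h, ← h']
      change t ((l • z).1 + (l' • z).1) + E.bridge X (E.bridgeMap _ ((l • z).2 + (l' • z).2)) = _
      simp only [map_add]
      exact add_add_add_comm _ _ _ _
    | mul l l' h h' => rw [mul_smul, h, h', mul_smul]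

theorem lift_apply (t : U →ₛₗ[(E.ι : S →+* Λ)] X) (z : E.Ind U) :
    E.lift t z = t z.1 + E.bridge X (E.bridgeMap (Corner.map rfl t) z.2) := rfl

@[simp]
theorem lift_incl (t : U →ₛₗ[(E.ι : S →+* Λ)] X) (u : U) : E.lift t (E.incl U u) = t u := by
  change t u + E.bridge X (E.bridgeMap _ 0) = t u
  rw [map_zero, map_zero, add_zero]

end Ind

section IndMap

variable {U V W : Type u} [AddCommGroup U] [Module S U] [AddCommGroup V] [Module S V]
  [AddCommGroup W] [Module S W]

/-- The map on induced modules. -/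
def indMap (g : U →ₗ[S] V) : E.Ind U →ₗ[Λ] E.Ind V := E.lift ((E.incl V).comp g)

theorem indMap_incl (g : U →ₗ[S] V) (u : U) : E.indMap g (E.incl U u) = E.incl V (g u) :=
  E.lift_incl _ u

theorem indMap_apply (g : U →ₗ[S] V) (z : E.Ind U) :
    E.indMap g z = (g z.1, E.bridgeMap (Corner.lmap K E.f g) z.2) := by
  rw [indMap, lift_apply, bridge_ind, bridgeMap_bridgeMap]
  exact Prod.ext (add_zero _) (zero_add _)

theorem indMap_injective {g : U →ₗ[S] V} (hg : Function.Injective g) :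
    Function.Injective (E.indMap g) := by
  have hg' : Function.Injective (Corner.lmap K E.f g) :=
    Corner.map_injective fun _ _ h => (map_eq_zero_iff g hg).1 h
  intro z w h
  rw [indMap_apply, indMap_apply] at h
  exact Prod.ext (hg (congrArg Prod.fst h)) (E.bridgeMap_injective hg' (congrArg Prod.snd h))

theorem indMap_exact {g : U →ₗ[S] V} {h : V →ₗ[S] W} (hgh : Function.Exact g h) :
    Function.Exact (E.indMap g) (E.indMap h) := by
  have hgh' := E.bridgeMap_exact (Corner.lmap_exact (K := K) E.f_mul_f hgh)
  intro z
  rw [indMap_apply]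
  refine ⟨fun hz => ?_, ?_⟩
  · obtain ⟨u, hu⟩ := (hgh _).1 (congrArg Prod.fst hz)
    obtain ⟨m, hm⟩ := (hgh' _).1 (congrArg Prod.snd hz)
    exact ⟨(u, m), (E.indMap_apply g _).trans (Prod.ext hu hm)⟩
  · rintro ⟨w, rfl⟩
    rw [indMap_apply]
    exact Prod.ext (hgh.apply_apply_eq_zero _) (hgh'.apply_apply_eq_zero _)

variable (U)

theorem finite_ind [Module.Finite S U] : Module.Finite Λ (E.Ind U) := by
  classical
  obtain ⟨s, hs⟩ := Module.Finite.fg_top (R := S) (M := U)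
  let N : Submodule Λ (E.Ind U) := Submodule.span Λ (E.incl U '' s)
  have hN : ⊤ ≤ N.comap (E.incl U) :=
    hs ▸ Submodule.span_le.2 fun u hu => Submodule.subset_span ⟨u, hu, rfl⟩
  have hq : N.mkQ = 0 := E.ind_hom_ext fun u => (Submodule.Quotient.mk_eq_zero N).2 (hN trivial)
  refine ⟨s.image (E.incl U), ?_⟩
  rw [Finset.coe_image]
  exact (Submodule.ker_mkQ N).symm.trans (LinearMap.ker_eq_top.2 hq)

theorem projective_ind [Module.Projective S U] : Module.Projective Λ (E.Ind U) := by
  refine Module.Projective.of_lifting_property'' fun p hp => ?_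
  obtain ⟨k, hk⟩ := exists_semilinear_lift hp (E.incl U)
  exact ⟨E.lift k, E.ind_hom_ext fun u => by simp [hk]⟩

theorem mk_incl_fst (z : E.Ind U) :
    Reduction.mk (E.ret : Λ →+* S) (E.incl U z.1) = Reduction.mk (E.ret : Λ →+* S) z := by
  conv_rhs => rw [← E.eq_incl_add_bridge z, map_add, mk_bridge, add_zero]

/-- The reduction of the module induced by `U` is `U`. -/
def reductionInd : Reduction (E.ret : Λ →+* S) (E.Ind U) ≃ₗ[S] U :=
  .ofBijective (Reduction.lift (E.proj U))
    ⟨(injective_iff_map_eq_zero _).2 <| (Reduction.mk_surjective _).forall.2 fun z hz => by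
      have hz : z.1 = 0 := hz
      rw [← mk_incl_fst, hz, map_zero, map_zero], fun u => ⟨Reduction.mk _ (E.incl U u), rfl⟩⟩

end IndMap

section Monic

variable (X : Type u) {Y : Type u} [AddCommGroup X] [Module Λ X] [AddCommGroup Y] [Module Λ Y]

/-- Modules on which the arrow acts by an injective map `S e ⊗ f X → X`, the analogue for `Λ` of
the monomorphism category of a triangular matrix algebra. -/
def IsMonic : Prop := Function.Injective (E.bridge X)

variable {X}

theorem IsMonic.of_injective (hY : E.IsMonic Y) {g : X →ₗ[Λ] Y} (hg : Function.Injective g) :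
    E.IsMonic X := by
  have hg' : Function.Injective (Corner.lmap K (E.ι E.f) g) :=
    Corner.map_injective fun _ _ h => (map_eq_zero_iff g hg).1 h
  refine Function.Injective.of_comp (f := g) ?_
  convert hY.comp (E.bridgeMap_injective hg') using 1
  exact funext (E.map_bridge g)

theorem isMonic_ind (U : Type u) [AddCommGroup U] [Module S U] : E.IsMonic (E.Ind U) :=
  E.bridge_ind_injective

variable (X) in
theorem exists_split_ind [Module.Projective Λ X] :
    let := Module.compHom X (E.ι : S →+* Λ)
    ∃ (i : X →ₗ[Λ] E.Ind X) (p : E.Ind X →ₗ[Λ] X), p ∘ₗ i = LinearMap.id := by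
  let := Module.compHom X (E.ι : S →+* Λ)
  let t : X →ₛₗ[(E.ι : S →+* Λ)] X := { AddMonoidHom.id X with map_smul' := fun _ _ => rfl }
  obtain ⟨i, hi⟩ := Module.projective_lifting_property (E.lift t) LinearMap.id
    fun x => ⟨E.incl X x, E.lift_incl t x⟩
  exact ⟨i, E.lift t, hi⟩

theorem isMonic_of_projective [Module.Projective Λ X] : E.IsMonic X := by
  let := Module.compHom X (E.ι : S →+* Λ)
  obtain ⟨i, p, hpi⟩ := E.exists_split_ind X
  exact (E.isMonic_ind X).of_injective _ (LinearMap.injective_of_comp_eq_id i p hpi)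

theorem isMonic_of_isGorensteinProjective {G : ModuleCat.{u} Λ} (hG : IsGorensteinProjective Λ G) :
    E.IsMonic G := by
  obtain ⟨P, i, -, hi, -⟩ := hG.exists_acyclicComplex rfl
  have := P.projective 0
  exact E.isMonic_of_projective.of_injective _ hi

variable (X) in
/-- The kernel of the projection of a module to its reduction. -/
def mkKer : Submodule Λ X := LinearMap.ker (Reduction.mk (E.ret : Λ →+* S) (X := X))

theorem mk_arrow_smul (x : X) : Reduction.mk (E.ret : Λ →+* S) (E.arrow • x) = 0 := by
  simp [map_smulₛₗ]

theorem IsMonic.projective_mkKer (hX : E.IsMonic X) : Module.Projective Λ (E.mkKer X) := by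
  let := Module.compHom (E.Se ⊗[K] Corner (E.ι E.f) X) (E.ret : Λ →+* S)
  let a : Corner (E.ι E.f) X →ₗ[K] Corner (E.ι E.e) (E.mkKer X) :=
    { toFun x := ⟨⟨E.arrow • x, E.mk_arrow_smul _⟩, Subtype.ext (E.arrowMap X x).2⟩
      map_add' x y := Subtype.ext (Subtype.ext (smul_add _ _ _))
      map_smul' c x := Subtype.ext <| Subtype.ext <|
        congrArg (fun y : Corner (E.ι E.e) X => (y : X)) ((E.arrowMap X).map_smul c x) }
  let β : E.Se ⊗[K] Corner (E.ι E.f) X →ₗ[Λ] E.mkKer X :=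
    { E.bridgeLift a with map_smul' l m := (E.smul_bridgeLift a l m).symm }
  have coe_β (m) : (β m : X) = E.bridge X m := E.map_bridgeLift (E.mkKer X).subtype a m
  have hβ : Function.Surjective β := fun x =>
    (E.mk_eq_zero_iff.1 x.2).imp fun m hm => Subtype.ext ((coe_β m).trans hm)
  refine Module.Projective.of_lifting_property'' fun p hp => ?_
  obtain ⟨k, hk⟩ := Module.projective_lifting_property (Corner.lmap K (E.ι E.e) p) a
    (Corner.lmap_surjective (by rw [← map_mul, E.e_mul_e]) hp)
  let s : E.Se ⊗[K] Corner (E.ι E.f) X →ₗ[Λ] _ :=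
    { E.bridgeLift k with map_smul' l m := (E.smul_bridgeLift k l m).symm }
  have hps (m) : p (s m) = β m := by
    refine (E.map_bridgeLift p k m).trans ?_
    rw [hk]
    rfl
  obtain ⟨g, hg⟩ := exists_comp_eq_of_ker_le hβ (k := s) fun m hm => by
    obtain rfl : m = 0 := hX <| by rw [← coe_β, hm, map_zero, ZeroMemClass.coe_zero]
    exact map_zero s
  refine ⟨g, LinearMap.ext (hβ.forall.2 fun m => ?_)⟩
  exact (congrArg p (LinearMap.congr_fun hg m)).trans (hps m)

theorem projective_ker_ret : Module.Projective Λ (RingHom.ker (E.ret : Λ →+* S)) := by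
  have := E.isMonic_of_projective (X := Λ).projective_mkKer
  refine .of_equiv (LinearEquiv.ofEq (E.mkKer Λ) _ (Submodule.ext fun l => ?_))
  exact Reduction.mk_eq_zero_iff.trans (by rw [smul_eq_mul, Ideal.mul_top])

theorem isExactBelowProjectives_ret :
    Reduction.IsExactBelowProjectives (E.ret : Λ →+* S) := by
  intro X Y Z Q _ _ _ _ _ _ _ _ _ f g h hfg hgh
  refine (Reduction.mk_surjective _).forall.2 fun y => ⟨fun hy => ?_, ?_⟩
  · obtain ⟨m, hm⟩ := E.mk_eq_zero_iff.1 hy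
    have hm' : E.bridgeMap (Corner.lmap K _ h) m = 0 := E.isMonic_of_projective <| by
      rw [← map_bridge, hm, hgh.apply_apply_eq_zero, map_zero]
    obtain ⟨t, rfl⟩ :=
      (E.bridgeMap_exact (Corner.lmap_exact (by rw [← map_mul, E.f_mul_f]) hgh) m).1 hm'
    obtain ⟨x, hx⟩ := (hfg (y - E.bridge Y t)).1 (by rw [map_sub, map_bridge, hm, sub_self])
    exact ⟨Reduction.mk _ x, by rw [Reduction.map_mk, hx, map_sub, mk_bridge, sub_zero]⟩
  · rintro ⟨x, hx⟩
    obtain ⟨x, rfl⟩ := Reduction.mk_surjective _ x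
    rw [← hx, Reduction.map_mk, Reduction.map_mk, hfg.apply_apply_eq_zero, map_zero]

theorem isStablyExact_ret : IsStablyExact (Reduction.functor (E.ret : Λ →+* S)) :=
  have := E.projective_ker_ret
  Reduction.isStablyExact E.isExactBelowProjectives_ret

end Monic

theorem projective_restrict :
    let := Module.compHom Λ (E.ι : S →+* Λ)
    Module.Projective S Λ := by
  let := Module.compHom Λ (E.ι : S →+* Λ)
  let t : S →ₛₗ[(E.ι : S →+* Λ)] Λ := { E.ι with map_smul' := map_mul E.ι }
  have ht : E.lift t (E.incl S 1) = 1 := (E.lift_incl t 1).trans (map_one E.ι)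
  obtain ⟨i, hi⟩ := Module.projective_lifting_property (E.lift t) LinearMap.id
    fun l => ⟨l • E.incl S 1, by rw [map_smul, ht, smul_eq_mul, mul_one]⟩
  refine .of_split (M := S × (E.Se ⊗[K] Corner E.f S))
    { toFun := i
      map_add' := map_add i
      map_smul' s l := (i.map_smul (E.ι s) l).trans (E.ι_smul S s _) }
    { toFun := E.lift t
      map_add' := map_add (E.lift t)
      map_smul' s z := (congrArg (E.lift t) (E.ι_smul S s z).symm).trans (map_smul _ _ _) }
    (LinearMap.ext fun l => LinearMap.congr_fun hi l)

theorem isGorensteinProjective_ind {U : ModuleCat.{u} S} (hU : IsGorensteinProjective S U) :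
    IsGorensteinProjective Λ (ModuleCat.of Λ (E.Ind U)) := by
  obtain ⟨P, i, hP, hi, hid⟩ := hU.exists_acyclicComplex rfl
  let P' : AcyclicComplex Λ :=
    { X n := ModuleCat.of Λ (E.Ind (P.X n))
      d n := E.indMap (P.d n)
      finite n := have := P.finite n; E.finite_ind (P.X n)
      projective n := have := P.projective n; E.projective_ind (P.X n)
      exact n := E.indMap_exact (P.exact n) }
  refine P'.isGorensteinProjective_of_exact (i := E.indMap i) (fun n g hg => ?_)
    (E.indMap_injective hi) (E.indMap_exact hid)
  let := Module.compHom Λ (E.ι : S →+* Λ)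
  have := E.projective_restrict
  let g' : P.X (n + 1) →ₗ[S] Λ :=
    { toFun x := g (E.incl _ x)
      map_add' x y := (congrArg g (map_add _ x y)).trans (map_add g _ _)
      map_smul' s x := (congrArg g ((E.incl _).map_smulₛₗ s x)).trans (g.map_smul _ _) }
  obtain ⟨k, hk⟩ := hP.of_projective (Q := Λ) n g' <| LinearMap.ext fun x =>
    (congrArg g (E.indMap_incl (P.d n) x).symm).trans (LinearMap.congr_fun hg (E.incl _ x))
  let k' : P.X (n + 1 + 1) →ₛₗ[(E.ι : S →+* Λ)] Λ := { k with map_smul' := k.map_smul }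
  refine ⟨E.lift k', E.ind_hom_ext fun x => ?_⟩
  exact (congrArg (E.lift k') (E.indMap_incl (P.d (n + 1)) x)).trans
    ((E.lift_incl k' _).trans (LinearMap.congr_fun hk x))

section Splitting

variable {X Y : ModuleCat.{u} Λ}

theorem exists_section (hX : IsGorensteinProjective Λ X) :
    ∃ t : Reduction (E.ret : Λ →+* S) X →ₛₗ[(E.ι : S →+* Λ)] X,
      ∀ y, Reduction.mk (E.ret : Λ →+* S) (t y) = y := by
  let := Module.compHom X (E.ι : S →+* Λ)
  let i : E.Se ⊗[K] Corner (E.ι E.f) X →ₗ[S] X :=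
    { E.bridge X with map_smul' := (E.bridge X).map_smulₛₗ }
  let p : X →ₗ[S] Reduction (E.ret : Λ →+* S) X :=
    { Reduction.mk (E.ret : Λ →+* S) with
      map_smul' s x := ((Reduction.mk _).map_smulₛₗ (E.ι s) x).trans
        (congrArg (· • Reduction.mk _ x) (E.ret_ι s)) }
  have hp : Function.Surjective p := Reduction.mk_surjective _
  have hip : Function.Exact i p := fun x => E.mk_eq_zero_iff
  obtain ⟨r, hr⟩ := (E.isStablyExact_ret.gproj X hX).exists_extension
    (i := i) (E.isMonic_of_isGorensteinProjective hX) hip hp LinearMap.id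
  obtain ⟨t, ht⟩ := exists_comp_eq_of_ker_le hp (k := LinearMap.id - i ∘ₗ r) fun x hx => by
    obtain ⟨m, rfl⟩ := (hip x).1 hx
    have hm : r (i m) = m := LinearMap.congr_fun hr m
    simp [hm]
  refine ⟨{ t with map_smul' := t.map_smul }, hp.forall.2 fun x => ?_⟩
  calc p (t (p x)) = p (x - i (r x)) := congrArg p (LinearMap.congr_fun ht x)
    _ = p x := by rw [map_sub, hip.apply_apply_eq_zero, sub_zero]

theorem map_section_surjective
    {t : Reduction (E.ret : Λ →+* S) X →ₛₗ[(E.ι : S →+* Λ)] X}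
    (ht : ∀ y, Reduction.mk (E.ret : Λ →+* S) (t y) = y) :
    Function.Surjective (Corner.map (ε := E.f) rfl t) := fun x => by
  let y : Corner E.f (Reduction (E.ret : Λ →+* S) X) :=
    Corner.map (E.ret_ι E.f) (Reduction.mk (E.ret : Λ →+* S)) x
  have h := E.f_smul_eq_zero
    (show Reduction.mk (E.ret : Λ →+* S) ((x : X) - t y) = 0 by
      rw [map_sub, ht]
      exact sub_self _)
  refine ⟨y, Subtype.ext ?_⟩
  rw [smul_sub, Corner.smul_coe, sub_eq_zero] at h
  exact (Corner.smul_coe (Corner.map (ε := E.f) rfl t y)).symm.trans h.symm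

theorem mk_lift {U : Type u} [AddCommGroup U] [Module S U] (t : U →ₛₗ[(E.ι : S →+* Λ)] Y)
    (z : E.Ind U) : Reduction.mk (E.ret : Λ →+* S) (E.lift t z) = Reduction.mk _ (t z.1) := by
  rw [lift_apply, map_add, mk_bridge, add_zero]

theorem exists_equiv_ind (hX : IsGorensteinProjective Λ X) :
    ∃ e : E.Ind (Reduction (E.ret : Λ →+* S) X) ≃ₗ[Λ] X,
      ∀ z, Reduction.mk (E.ret : Λ →+* S) (e z) = z.1 := by
  obtain ⟨t, ht⟩ := E.exists_section hX
  have hlift (z) : Reduction.mk (E.ret : Λ →+* S) (E.lift t z) = z.1 :=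
    (E.mk_lift t z).trans (ht z.1)
  refine ⟨.ofBijective (E.lift t) ⟨(injective_iff_map_eq_zero (E.lift t)).2 fun z hz => ?_,
    fun x => ?_⟩, hlift⟩
  · have hz₁ : z.1 = 0 := by rw [← hlift, hz, map_zero]
    rw [lift_apply, hz₁, map_zero, zero_add] at hz
    have ht₀ : Function.Injective (Corner.map (ε := E.f) rfl t) :=
      Corner.map_injective fun y _ hy => by rw [← ht y, hy, map_zero]
    have hz₂ := E.isMonic_of_isGorensteinProjective hX (hz.trans (map_zero _).symm)
    exact Prod.ext hz₁ (E.bridgeMap_injective ht₀ (hz₂.trans (map_zero _).symm))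
  · obtain ⟨m, hm⟩ := E.mk_eq_zero_iff.1
      (show Reduction.mk (E.ret : Λ →+* S) (x - t (Reduction.mk _ x)) = 0 by
        rw [map_sub, ht, sub_self])
    obtain ⟨m, rfl⟩ := E.bridgeMap_surjective (E.map_section_surjective ht) m
    refine ⟨(Reduction.mk _ x, m), ?_⟩
    change t (Reduction.mk _ x) + E.bridge X _ = x
    rw [hm, add_sub_cancel]

variable {U : Type u} [AddCommGroup U] [Module S U]

theorem exists_hom_to_ind (hX : IsGorensteinProjective Λ X)
    (a : Reduction (E.ret : Λ →+* S) X →ₗ[S] U) :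
    ∃ a' : X →ₗ[Λ] E.Ind U, ∀ x, (a' x).1 = a (Reduction.mk _ x) := by
  obtain ⟨e, he⟩ := E.exists_equiv_ind hX
  refine ⟨E.indMap a ∘ₗ e.symm, e.surjective.forall.2 fun z => ?_⟩
  change (E.indMap a (e.symm (e z))).1 = _
  rw [he, e.symm_apply_apply, indMap_apply]

theorem exists_hom_from_ind (hY : IsGorensteinProjective Λ Y)
    (b : U →ₗ[S] Reduction (E.ret : Λ →+* S) Y) :
    ∃ b' : E.Ind U →ₗ[Λ] Y, ∀ z, Reduction.mk (E.ret : Λ →+* S) (b' z) = b z.1 := by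
  obtain ⟨t, ht⟩ := E.exists_section hY
  exact ⟨E.lift (t.comp b), fun z => (E.mk_lift _ z).trans (ht _)⟩

theorem exists_map_eq (hX : IsGorensteinProjective Λ X) (hY : IsGorensteinProjective Λ Y)
    (g : Reduction (E.ret : Λ →+* S) X →ₗ[S] Reduction (E.ret : Λ →+* S) Y) :
    ∃ f : X →ₗ[Λ] Y, Reduction.map (E.ret : Λ →+* S) f = g := by
  obtain ⟨a, ha⟩ := E.exists_hom_to_ind hX g
  obtain ⟨b, hb⟩ := E.exists_hom_from_ind hY LinearMap.id
  exact ⟨b ∘ₗ a, Reduction.hom_ext fun x => (hb (a x)).trans (ha x)⟩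

theorem factorsThroughProjective_of_map (hX : IsGorensteinProjective Λ X)
    (hY : IsGorensteinProjective Λ Y) (f : X ⟶ Y)
    (hf : FactorsThroughProjective ((Reduction.functor (E.ret : Λ →+* S)).map f)) :
    FactorsThroughProjective f := by
  obtain ⟨Q, _, _, a, b, hab⟩ := hf
  obtain ⟨a', ha'⟩ := E.exists_hom_to_ind hX a.hom
  obtain ⟨b', hb'⟩ := E.exists_hom_from_ind hY b.hom
  let f' : X ⟶ Y := ModuleCat.ofHom a' ≫ ModuleCat.ofHom b'
  have hf' : FactorsThroughProjective f' :=
    ⟨ModuleCat.of Λ (E.Ind Q), E.finite_ind Q, E.projective_ind Q, ModuleCat.ofHom a',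
      ModuleCat.ofHom b', rfl⟩
  have hker (x) : (f - f').hom x ∈ E.mkKer Y := by
    have h : Reduction.mk (E.ret : Λ →+* S) (f.hom x) = b.hom (a.hom (Reduction.mk _ x)) :=
      congrArg (fun g => g.hom (Reduction.mk _ x)) hab
    refine ((Reduction.mk _).map_sub (f.hom x) (b' (a' x))).trans (sub_eq_zero.2 ?_)
    exact h.trans ((hb' _).trans (congrArg b.hom (ha' x))).symm
  have := hX.finite
  have := (E.isMonic_of_isGorensteinProjective hY).projective_mkKer
  have h := (FactorsThroughProjective.of_finite_of_projective
    (ModuleCat.ofHom ((f - f').hom.codRestrict (E.mkKer Y) hker))).comp_right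
      (ModuleCat.ofHom (E.mkKer Y).subtype)
  exact sub_add_cancel f f' ▸ FactorsThroughProjective.add h hf'

end Splitting

theorem stableFunctor_isEquivalence : E.isStablyExact_ret.stableFunctor.IsEquivalence where
  full.map_surjective {X Y} g := by
    obtain ⟨g, rfl⟩ := (CategoryTheory.Quotient.functor (stableRel S)).map_surjective g
    obtain ⟨f, hf⟩ := E.exists_map_eq X.as.property Y.as.property g.hom.hom
    let f' : X.as ⟶ Y.as := ObjectProperty.homMk (ModuleCat.ofHom f)
    refine ⟨(StableGProj.proj Λ).map f', congrArg (StableGProj.proj S).map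
      (?_ : E.isStablyExact_ret.gprojFunctor.map f' = g)⟩
    exact ObjectProperty.hom_ext _ (ModuleCat.hom_ext hf)
  faithful.map_injective {X Y f g} hfg := by
    obtain ⟨f, rfl⟩ := (CategoryTheory.Quotient.functor (stableRel Λ)).map_surjective f
    obtain ⟨g, rfl⟩ := (CategoryTheory.Quotient.functor (stableRel Λ)).map_surjective g
    exact CategoryTheory.Quotient.sound _ (E.factorsThroughProjective_of_map X.as.property
      Y.as.property _ ((E.isStablyExact_ret.stableFunctor_map_eq_iff f g).1 hfg))
  essSurj.mem_essImage U :=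
    let X : GProj Λ := ⟨_, E.isGorensteinProjective_ind U.as.property⟩
    let e : E.isStablyExact_ret.gprojFunctor.obj X ≅ U.as :=
      (gprojProperty S).isoMk (E.reductionInd U.as.obj).toModuleIso
    ⟨(StableGProj.proj Λ).obj X, ⟨(StableGProj.proj S).mapIso e⟩⟩

/-- Adjoining an arrow does not change the stable category. -/
def triangleEquivalence : TriangleEquivalence K (StableGProj Λ) (StableGProj S) :=
  have := E.stableFunctor_isEquivalence
  have := Reduction.functor_linear (σ := (E.ret : Λ →+* S)) K E.ret.commutes
  E.isStablyExact_ret.triangleEquivalence K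

variable {T Γ : Type u} [Ring T] [Ring Γ] [Algebra K T] [Algebra K Γ]

/-- If `T = S / 𝔞`, then the quotient of `Λ` by the ideal which `𝔞` generates is obtained from `T`
by adjoining an arrow. -/
def ofSurjective (E : ArrowExtension K S Λ) {π : S →ₐ[K] T} (hπ : Function.Surjective π)
    {ϖ : Λ →ₐ[K] Γ} (hϖ : Function.Surjective ϖ)
    (hker : TwoSidedIdeal.ker ϖ = TwoSidedIdeal.span (E.ι '' {s | π s = 0})) :
    ArrowExtension K T Γ :=
  have h : ∃ ι : T →ₐ[K] Γ, ∀ s, ι (π s) = ϖ (E.ι s) :=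
    exists_algHom_of_surjective hπ (φ := ϖ.comp E.ι) fun s hs =>
      (TwoSidedIdeal.mem_ker ϖ).1 (hker ▸ TwoSidedIdeal.subset_span ⟨s, hs, rfl⟩)
  have hι := h.choose_spec
  { ι := h.choose
    arrow := ϖ E.arrow
    e := π E.e
    f := π E.f
    e_mul_e := by rw [← map_mul, E.e_mul_e]
    f_mul_f := by rw [← map_mul, E.f_mul_f]
    f_mul_mul_e := hπ.forall.2 fun s => by rw [← map_mul, ← map_mul, E.f_mul_mul_e, map_zero]
    e_mul_arrow := by rw [hι, ← map_mul, E.e_mul_arrow]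
    arrow_mul_f := by rw [hι, ← map_mul, E.arrow_mul_f]
    adjoin_eq_top := by
      refine Algebra.eq_top_iff.2 (hϖ.forall.2 fun l => ?_)
      induction l using E.induction with
      | incl s => exact Algebra.subset_adjoin (Or.inl ⟨π s, hι s⟩)
      | arrow => exact Algebra.subset_adjoin (Or.inr rfl)
      | add l m hl hm => exact map_add ϖ l m ▸ add_mem hl hm
      | mul l m hl hm => exact map_mul ϖ l m ▸ mul_mem hl hm
    exists_lift φ a hφ hψ := by
      obtain ⟨ρ, hρ, hρa⟩ := E.exists_lift (φ.comp π) a hφ hψ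
      have hle : TwoSidedIdeal.ker ϖ ≤ TwoSidedIdeal.ker ρ := by
        rw [hker, TwoSidedIdeal.span_le]
        rintro _ ⟨s, hs, rfl⟩
        exact (TwoSidedIdeal.mem_ker ρ).2 ((hρ s).trans ((congrArg φ hs).trans (map_zero φ)))
      obtain ⟨ρ', hρ'⟩ := exists_algHom_of_surjective hϖ fun l hl =>
        (TwoSidedIdeal.mem_ker ρ).1 (hle ((TwoSidedIdeal.mem_ker ϖ).2 hl))
      exact ⟨ρ', hπ.forall.2 fun s => by rw [hι, hρ', hρ]; rfl, (hρ' _).trans hρa⟩ }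

end ArrowExtension

/-! ## Products of rings -/

namespace Reduction

variable {R A : Type u} [Ring R] [Ring A] {σ : R →+* A} {ε : R}

theorem projective_ker_of_idempotent (hε : σ ε = 1) (h : ∀ k ∈ RingHom.ker σ, k * ε = 0) :
    Module.Projective R (RingHom.ker σ) := by
  have hmem (r : R) : r * (1 - ε) ∈ RingHom.ker σ := by
    rw [RingHom.mem_ker, map_mul, map_sub, map_one, hε, sub_self, mul_zero]
  refine .of_split (M := R) (RingHom.ker σ).subtype
    ((LinearMap.toSpanSingleton R R (1 - ε)).codRestrict (RingHom.ker σ) hmem)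
    (LinearMap.ext fun k => Subtype.ext ?_)
  change (k : R) * (1 - ε) = k
  rw [mul_sub, mul_one, h k k.2, sub_zero]

variable [RingHomSurjective σ]

theorem mk_eq_zero_iff_smul_eq_zero {X : Type u} [AddCommGroup X] [Module R X] (hε : σ ε = 1)
    (h : ∀ k ∈ RingHom.ker σ, ε * k = 0) {x : X} : mk σ x = 0 ↔ ε • x = 0 := by
  constructor <;> intro hx
  · rw [mk_eq_zero_iff] at hx
    induction hx using Submodule.smul_induction_on' with
    | smul r hr x _ => rw [← mul_smul, h r hr, zero_smul]
    | add x _ y _ hx hy => rw [smul_add, hx, hy, add_zero]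
  · rw [← one_smul A (mk σ x), ← hε, ← map_smulₛₗ, hx, map_zero]

theorem isExactBelowProjectives_of_idempotent (hε : σ ε = 1)
    (h : ∀ k ∈ RingHom.ker σ, ε * k = 0) : IsExactBelowProjectives σ := by
  intro X Y Z _ _ _ _ _ _ _ _ _ _ f g _ hfg _
  refine (mk_surjective σ).forall.2 fun y => ⟨fun hy => ?_, ?_⟩
  · rw [map_mk, mk_eq_zero_iff_smul_eq_zero hε h, ← map_smul] at hy
    obtain ⟨x, hx⟩ := (hfg _).1 hy
    exact ⟨mk σ x, by rw [map_mk, hx, map_smulₛₗ, hε, one_smul]⟩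
  · rintro ⟨x, hx⟩
    obtain ⟨x, rfl⟩ := mk_surjective σ x
    rw [← hx, map_mk, map_mk, hfg.apply_apply_eq_zero, map_zero]

end Reduction

namespace ProductRing

variable {B C : Type u} [Ring B] [Ring C]

instance : RingHomSurjective (RingHom.fst B C) := ⟨Prod.fst_surjective⟩

instance : RingHomSurjective (RingHom.snd B C) := ⟨Prod.snd_surjective⟩

theorem mul_eq_zero_of_mem_ker_fst (k : B × C) (hk : k ∈ RingHom.ker (RingHom.fst B C)) :
    (1, 0) * k = 0 ∧ k * (1, 0) = 0 :=
  have hk : k.1 = 0 := hk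
  ⟨Prod.ext ((one_mul _).trans hk) (zero_mul _), Prod.ext ((mul_one _).trans hk) (mul_zero _)⟩

theorem mul_eq_zero_of_mem_ker_snd (k : B × C) (hk : k ∈ RingHom.ker (RingHom.snd B C)) :
    (0, 1) * k = 0 ∧ k * (0, 1) = 0 :=
  have hk : k.2 = 0 := hk
  ⟨Prod.ext (zero_mul _) ((one_mul _).trans hk), Prod.ext (mul_zero _) ((mul_one _).trans hk)⟩

variable (B C) in
theorem isStablyExact_fst : IsStablyExact (Reduction.functor (RingHom.fst B C)) :=
  have := Reduction.projective_ker_of_idempotent (σ := RingHom.fst B C) rfl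
    fun k hk => (mul_eq_zero_of_mem_ker_fst k hk).2
  Reduction.isStablyExact <| Reduction.isExactBelowProjectives_of_idempotent rfl
    fun k hk => (mul_eq_zero_of_mem_ker_fst k hk).1

variable (B C) in
theorem isStablyExact_snd : IsStablyExact (Reduction.functor (RingHom.snd B C)) :=
  have := Reduction.projective_ker_of_idempotent (σ := RingHom.snd B C) rfl
    fun k hk => (mul_eq_zero_of_mem_ker_snd k hk).2
  Reduction.isStablyExact <| Reduction.isExactBelowProjectives_of_idempotent rfl
    fun k hk => (mul_eq_zero_of_mem_ker_snd k hk).1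

/-- The product of a `B`-module and a `C`-module, as a module over `B × C`. -/
def ExternalProd (U W : Type u) : Type u := U × W

namespace ExternalProd

variable {U U' U'' W W' W'' : Type u} [AddCommGroup U] [Module B U] [AddCommGroup U'] [Module B U']
  [AddCommGroup U''] [Module B U''] [AddCommGroup W] [Module C W] [AddCommGroup W'] [Module C W']
  [AddCommGroup W''] [Module C W''] {X Y : Type u} [AddCommGroup X] [Module (B × C) X]
  [AddCommGroup Y] [Module (B × C) Y]

instance : AddCommGroup (ExternalProd U W) := inferInstanceAs (AddCommGroup (U × W))

instance : Module (B × C) (ExternalProd U W) where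
  smul r z := (r.1 • z.1, r.2 • z.2)
  one_smul z := Prod.ext (one_smul B z.1) (one_smul C z.2)
  mul_smul r s z := Prod.ext (mul_smul r.1 s.1 z.1) (mul_smul r.2 s.2 z.2)
  smul_zero r := Prod.ext (smul_zero r.1) (smul_zero r.2)
  smul_add r z w := Prod.ext (smul_add r.1 z.1 w.1) (smul_add r.2 z.2 w.2)
  add_smul r s z := Prod.ext (add_smul r.1 s.1 z.1) (add_smul r.2 s.2 z.2)
  zero_smul z := Prod.ext (zero_smul B z.1) (zero_smul C z.2)

/-- The componentwise homomorphism. -/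
def map (g : U →ₗ[B] U') (h : W →ₗ[C] W') : ExternalProd U W →ₗ[B × C] ExternalProd U' W' where
  toFun z := (g z.1, h z.2)
  map_add' z w := Prod.ext (map_add g z.1 w.1) (map_add h z.2 w.2)
  map_smul' r z := Prod.ext (map_smul g r.1 z.1) (map_smul h r.2 z.2)

variable (U W) in
/-- The first projection. -/
def fst : ExternalProd U W →ₛₗ[RingHom.fst B C] U where
  toFun z := z.1
  map_add' _ _ := rfl
  map_smul' _ _ := rfl

variable (U W) in
/-- The second projection. -/
def snd : ExternalProd U W →ₛₗ[RingHom.snd B C] W where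
  toFun z := z.2
  map_add' _ _ := rfl
  map_smul' _ _ := rfl

theorem map_injective {g : U →ₗ[B] U'} {h : W →ₗ[C] W'} (hg : Function.Injective g)
    (hh : Function.Injective h) : Function.Injective (map g h) :=
  hg.prodMap hh

theorem map_exact {g : U →ₗ[B] U'} {g' : U' →ₗ[B] U''} {h : W →ₗ[C] W'} {h' : W' →ₗ[C] W''}
    (hg : Function.Exact g g') (hh : Function.Exact h h') :
    Function.Exact (map g h) (map g' h') := fun z => by
  refine (Prod.ext_iff.trans (and_congr (hg z.1) (hh z.2))).trans ⟨?_, ?_⟩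
  · rintro ⟨⟨u, hu⟩, w, hw⟩
    exact ⟨(u, w), Prod.ext hu hw⟩
  · rintro ⟨z, rfl⟩
    exact ⟨⟨z.1, rfl⟩, z.2, rfl⟩

variable (U W) in
theorem finite [Module.Finite B U] [Module.Finite C W] :
    Module.Finite (B × C) (ExternalProd U W) := by
  obtain ⟨m, g, hg⟩ := Module.Finite.exists_fin' B U
  obtain ⟨n, h, hh⟩ := Module.Finite.exists_fin' C W
  let f : (Fin m → B × C) × (Fin n → B × C) →ₗ[B × C] ExternalProd U W :=
    { toFun x := (g fun i => (x.1 i).1, h fun i => (x.2 i).2)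
      map_add' x y := Prod.ext (map_add g _ _) (map_add h _ _)
      map_smul' r x := Prod.ext (map_smul g r.1 _) (map_smul h r.2 _) }
  refine .of_surjective f fun z => ?_
  obtain ⟨⟨x, hx⟩, y, hy⟩ := And.intro (hg z.1) (hh z.2)
  exact ⟨(fun i => (x i, 0), fun i => (0, y i)), Prod.ext hx hy⟩

variable (X) in
/-- The map from a module over `B × C` to the product of its reductions. -/
def toReductions :
    X →ₗ[B × C] ExternalProd (Reduction (RingHom.fst B C) X) (Reduction (RingHom.snd B C) X) where
  toFun x := (Reduction.mk (RingHom.fst B C) x, Reduction.mk (RingHom.snd B C) x)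
  map_add' x y := Prod.ext (map_add _ x y) (map_add _ x y)
  map_smul' r x := Prod.ext (map_smulₛₗ _ r x) (map_smulₛₗ _ r x)

theorem mk_fst_eq_zero_iff {x : X} :
    Reduction.mk (RingHom.fst B C) x = 0 ↔ ((1, 0) : B × C) • x = 0 :=
  Reduction.mk_eq_zero_iff_smul_eq_zero (σ := RingHom.fst B C) rfl
    fun k hk => (mul_eq_zero_of_mem_ker_fst k hk).1

theorem mk_snd_eq_zero_iff {x : X} :
    Reduction.mk (RingHom.snd B C) x = 0 ↔ ((0, 1) : B × C) • x = 0 :=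
  Reduction.mk_eq_zero_iff_smul_eq_zero (σ := RingHom.snd B C) rfl
    fun k hk => (mul_eq_zero_of_mem_ker_snd k hk).1

variable (X) in
theorem toReductions_bijective : Function.Bijective (toReductions (B := B) (C := C) X) := by
  have one_eq : (1 : B × C) = (1, 0) + (0, 1) := Prod.ext (add_zero _).symm (zero_add _).symm
  refine ⟨(injective_iff_map_eq_zero _).2 fun x hx => ?_, fun z => ?_⟩
  · rw [← one_smul (B × C) x, one_eq, add_smul, mk_fst_eq_zero_iff.1 (congrArg Prod.fst hx),
      mk_snd_eq_zero_iff.1 (congrArg Prod.snd hx), add_zero]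
  · obtain ⟨x, hx⟩ := Reduction.mk_surjective (RingHom.fst B C) z.1
    obtain ⟨y, hy⟩ := Reduction.mk_surjective (RingHom.snd B C) z.2
    refine ⟨((1, 0) : B × C) • x + ((0, 1) : B × C) • y, Prod.ext ?_ ?_⟩
    · change Reduction.mk (RingHom.fst B C) _ = z.1
      simp [map_smulₛₗ, hx]
    · change Reduction.mk (RingHom.snd B C) _ = z.2
      simp [map_smulₛₗ, hy]

variable (X) in
/-- A module over `B × C` is the product of its reductions. -/
def equivReductions :
    X ≃ₗ[B × C] ExternalProd (Reduction (RingHom.fst B C) X) (Reduction (RingHom.snd B C) X) :=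
  .ofBijective (toReductions X) (toReductions_bijective X)

/-- The reduction of a product to its first factor. -/
def reductionFst : Reduction (RingHom.fst B C) (ExternalProd U W) ≃ₗ[B] U :=
  .ofBijective (Reduction.lift (fst U W))
    ⟨(injective_iff_map_eq_zero _).2 <| (Reduction.mk_surjective _).forall.2 fun z hz => by
      have hz : z.1 = 0 := hz
      exact mk_fst_eq_zero_iff.2
        (Prod.ext ((congrArg _ hz).trans (smul_zero _)) (zero_smul C z.2)),
    fun u => ⟨Reduction.mk _ (u, 0), rfl⟩⟩

/-- The reduction of a product to its second factor. -/
def reductionSnd : Reduction (RingHom.snd B C) (ExternalProd U W) ≃ₗ[C] W :=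
  .ofBijective (Reduction.lift (snd U W))
    ⟨(injective_iff_map_eq_zero _).2 <| (Reduction.mk_surjective _).forall.2 fun z hz => by
      have hz : z.2 = 0 := hz
      exact mk_snd_eq_zero_iff.2
        (Prod.ext (zero_smul B z.1) ((congrArg _ hz).trans (smul_zero _))),
    fun w => ⟨Reduction.mk _ (0, w), rfl⟩⟩

theorem exists_map_eq (f : ExternalProd U W →ₗ[B × C] ExternalProd U' W') :
    ∃ (g : U →ₗ[B] U') (h : W →ₗ[C] W'), map g h = f := by
  let e := reductionFst (B := B) (C := C) (U := U) (W := W)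
  let e' := reductionSnd (B := B) (C := C) (U := U) (W := W)
  let f₁ := Reduction.lift ((fst U' W').comp f)
  let f₂ := Reduction.lift ((snd U' W').comp f)
  exact ⟨f₁ ∘ₗ e.symm, f₂ ∘ₗ e'.symm, LinearMap.ext fun z => Prod.ext
    (congrArg f₁ (e.symm_apply_apply (Reduction.mk _ z)))
    (congrArg f₂ (e'.symm_apply_apply (Reduction.mk _ z)))⟩

variable (U W) in
theorem projective [Module.Projective B U] [Module.Projective C W] :
    Module.Projective (B × C) (ExternalProd U W) := by
  refine .of_lifting_property'' fun p hp => ?_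
  obtain ⟨g, hg⟩ := Module.projective_lifting_property (Reduction.lift ((fst U W).comp p))
    LinearMap.id fun u => by
      obtain ⟨x, hx⟩ := hp (u, 0)
      exact ⟨Reduction.mk _ x, congrArg Prod.fst hx⟩
  obtain ⟨h, hh⟩ := Module.projective_lifting_property (Reduction.lift ((snd U W).comp p))
    LinearMap.id fun w => by
      obtain ⟨x, hx⟩ := hp (0, w)
      exact ⟨Reduction.mk _ x, congrArg Prod.snd hx⟩
  let e := equivReductions (B := B) (C := C) (ExternalProd U W →₀ B × C)
  refine ⟨e.symm ∘ₗ map g h, LinearMap.ext fun z => ?_⟩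
  obtain ⟨x, hx⟩ := e.surjective (map g h z)
  have h₁ : Reduction.mk (RingHom.fst B C) x = g z.1 := congrArg Prod.fst hx
  have h₂ : Reduction.mk (RingHom.snd B C) x = h z.2 := congrArg Prod.snd hx
  change p (e.symm (map g h z)) = z
  rw [← hx, LinearEquiv.symm_apply_apply]
  exact Prod.ext
    ((congrArg (Reduction.lift ((fst U W).comp p)) h₁).trans (LinearMap.congr_fun hg z.1))
    ((congrArg (Reduction.lift ((snd U W).comp p)) h₂).trans (LinearMap.congr_fun hh z.2))

theorem isGorensteinProjective {U : ModuleCat.{u} B} {W : ModuleCat.{u} C}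
    (hU : IsGorensteinProjective B U) (hW : IsGorensteinProjective C W) :
    IsGorensteinProjective (B × C) (ModuleCat.of (B × C) (ExternalProd U W)) := by
  obtain ⟨P, i, hP, hi, hid⟩ := hU.exists_acyclicComplex rfl
  obtain ⟨P', i', hP', hi', hid'⟩ := hW.exists_acyclicComplex rfl
  let T : AcyclicComplex (B × C) :=
    { X n := ModuleCat.of (B × C) (ExternalProd (P.X n) (P'.X n))
      d n := map (P.d n) (P'.d n)
      finite n := have := P.finite n; have := P'.finite n; finite (P.X n) (P'.X n)
      projective n :=
        have := P.projective n
        have := P'.projective n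
        projective (P.X n) (P'.X n)
      exact n := map_exact (P.exact n) (P'.exact n) }
  refine T.isGorensteinProjective_of_exact (i := map i i') (fun n f hf => ?_)
    (map_injective hi hi') (map_exact hid hid')
  obtain ⟨g, h, hgh⟩ := exists_map_eq (U' := B) (W' := C) f
  have hf (z) : map g h (map (P.d n) (P'.d n) z) = 0 := by
    rw [hgh]
    exact LinearMap.congr_fun hf z
  obtain ⟨k, hk⟩ := hP n g (LinearMap.ext fun u => congrArg Prod.fst (hf (u, 0)))
  obtain ⟨k', hk'⟩ := hP' n h (LinearMap.ext fun w => congrArg Prod.snd (hf (0, w)))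
  refine ⟨map k k', Eq.trans (LinearMap.ext fun z => ?_) hgh⟩
  exact Prod.ext (LinearMap.congr_fun hk z.1) (LinearMap.congr_fun hk' z.2)

theorem exists_map_reduction_eq
    (g : Reduction (RingHom.fst B C) X →ₗ[B] Reduction (RingHom.fst B C) Y)
    (h : Reduction (RingHom.snd B C) X →ₗ[C] Reduction (RingHom.snd B C) Y) :
    ∃ f : X →ₗ[B × C] Y,
      Reduction.map (RingHom.fst B C) f = g ∧ Reduction.map (RingHom.snd B C) f = h := by
  let e := equivReductions (B := B) (C := C) X
  let e' := equivReductions (B := B) (C := C) Y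
  have he (x) : e' (e'.symm (map g h (e x))) = map g h (e x) := e'.apply_symm_apply _
  exact ⟨e'.symm.toLinearMap ∘ₗ map g h ∘ₗ e.toLinearMap,
    Reduction.hom_ext fun x => congrArg Prod.fst (he x),
    Reduction.hom_ext fun x => congrArg Prod.snd (he x)⟩

theorem factorsThroughProjective {X Y : ModuleCat.{u} (B × C)} (f : X ⟶ Y)
    (hf₁ : FactorsThroughProjective ((Reduction.functor (RingHom.fst B C)).map f))
    (hf₂ : FactorsThroughProjective ((Reduction.functor (RingHom.snd B C)).map f)) :
    FactorsThroughProjective f := by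
  obtain ⟨Q, _, _, a, b, hab⟩ := hf₁
  obtain ⟨Q', _, _, a', b', hab'⟩ := hf₂
  let e := equivReductions (B := B) (C := C) X
  let e' := equivReductions (B := B) (C := C) Y
  refine ⟨ModuleCat.of (B × C) (ExternalProd Q Q'), finite Q Q', projective Q Q',
    ModuleCat.ofHom (map a.hom a'.hom ∘ₗ e.toLinearMap),
    ModuleCat.ofHom (e'.symm.toLinearMap ∘ₗ map b.hom b'.hom),
    ModuleCat.hom_ext (LinearMap.ext fun x => e'.injective ?_)⟩
  refine Eq.trans ?_ (e'.apply_symm_apply _).symm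
  exact Prod.ext (congrArg (fun g => g.hom (Reduction.mk _ x)) hab)
    (congrArg (fun g => g.hom (Reduction.mk _ x)) hab')

variable (B C) in
theorem prod_stableFunctor_isEquivalence :
    ((isStablyExact_fst B C).stableFunctor.prod' (isStablyExact_snd B C).stableFunctor
      ).IsEquivalence where
  full.map_surjective {X Y} g := by
    obtain ⟨g₁, hg₁⟩ := (CategoryTheory.Quotient.functor (stableRel B)).map_surjective g.1
    obtain ⟨g₂, hg₂⟩ := (CategoryTheory.Quotient.functor (stableRel C)).map_surjective g.2
    obtain ⟨f, hf₁, hf₂⟩ := exists_map_reduction_eq g₁.hom.hom g₂.hom.hom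
    let f' : X.as ⟶ Y.as := ObjectProperty.homMk (ModuleCat.ofHom f)
    have hf₁ : (isStablyExact_fst B C).gprojFunctor.map f' = g₁ :=
      ObjectProperty.hom_ext _ (ModuleCat.hom_ext hf₁)
    have hf₂ : (isStablyExact_snd B C).gprojFunctor.map f' = g₂ :=
      ObjectProperty.hom_ext _ (ModuleCat.hom_ext hf₂)
    exact ⟨(StableGProj.proj (B × C)).map f',
      Prod.ext ((congrArg (StableGProj.proj B).map hf₁).trans hg₁)
        ((congrArg (StableGProj.proj C).map hf₂).trans hg₂)⟩
  faithful.map_injective {X Y f g} hfg := by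
    obtain ⟨f, rfl⟩ := (CategoryTheory.Quotient.functor (stableRel (B × C))).map_surjective f
    obtain ⟨g, rfl⟩ := (CategoryTheory.Quotient.functor (stableRel (B × C))).map_surjective g
    exact CategoryTheory.Quotient.sound _ (factorsThroughProjective _
      (((isStablyExact_fst B C).stableFunctor_map_eq_iff f g).1 (congrArg Prod.fst hfg))
      (((isStablyExact_snd B C).stableFunctor_map_eq_iff f g).1 (congrArg Prod.snd hfg)))
  essSurj.mem_essImage Z :=
    let X : GProj (B × C) := ⟨_, isGorensteinProjective Z.1.as.property Z.2.as.property⟩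
    let e₁ : (isStablyExact_fst B C).gprojFunctor.obj X ≅ Z.1.as :=
      (gprojProperty B).isoMk reductionFst.toModuleIso
    let e₂ : (isStablyExact_snd B C).gprojFunctor.obj X ≅ Z.2.as :=
      (gprojProperty C).isoMk reductionSnd.toModuleIso
    ⟨(StableGProj.proj (B × C)).obj X,
      ⟨Iso.prod ((StableGProj.proj B).mapIso e₁) ((StableGProj.proj C).mapIso e₂)⟩⟩

end ExternalProd

variable (B C) (K : Type u) [Field K] [Algebra K B] [Algebra K C]

/-- The stable category of a product of two algebras is the product of the stable categories. -/
def triangleEquivalence :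
    TriangleEquivalence K (StableGProj (B × C)) (StableGProj B × StableGProj C) :=
  have := ExternalProd.prod_stableFunctor_isEquivalence B C
  have := Reduction.functor_linear (σ := RingHom.fst B C) K fun _ => rfl
  have := Reduction.functor_linear (σ := RingHom.snd B C) K fun _ => rfl
  (isStablyExact_fst B C).prodTriangleEquivalence K (isStablyExact_snd B C)

end ProductRing

/-! ## Path algebras -/

namespace PathAlgebra

section Paths

variable (K : Type u) {V : Type u} [Field K] [Quiver.{u} V] [Fintype V]

/-- The basis of the path algebra which consists of the paths. -/
def pathBasis (V : Type u) [Quiver.{u} V] [Fintype V] :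
    Module.Basis (Σ a b : V, Quiver.Path a b) K (PathAlgebra K V) :=
  Pi.basis fun _ => Pi.basis fun _ => Finsupp.basisSingleOne

/-- The basis element given by a path. -/
def ofPath {a b : V} (p : Quiver.Path a b) : PathAlgebra K V := pathBasis K V ⟨a, b, p⟩

variable {K}

theorem ofPath_eq_single [DecidableEq V] {a b : V} (p : Quiver.Path a b) :
    ofPath K p =
      (Pi.single a (Pi.single b (Finsupp.single p 1)) : ∀ a b : V, Quiver.Path a b →₀ K) :=
  (Pi.basis_apply _ _).trans <| congrArg _ <| (Pi.basis_apply _ _).trans <|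
    congrArg _ <| congrFun Finsupp.coe_basisSingleOne p

theorem ofPath_apply_self {a b : V} (p : Quiver.Path a b) :
    ofPath K p a b = Finsupp.single p 1 := by
  classical
  rw [ofPath_eq_single, Pi.single_eq_same, Pi.single_eq_same]

theorem ofPath_apply_of_left_ne {a b : V} (p : Quiver.Path a b) {a' : V} (b' : V) (h : a' ≠ a) :
    ofPath K p a' b' = 0 := by
  classical
  rw [ofPath_eq_single, Pi.single_eq_of_ne h, Pi.zero_apply]

theorem ofPath_apply_of_right_ne {a b : V} (p : Quiver.Path a b) (a' : V) {b' : V} (h : b' ≠ b) :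
    ofPath K p a' b' = 0 := by
  classical
  obtain rfl | ha := eq_or_ne a' a
  · rw [ofPath_eq_single, Pi.single_eq_same, Pi.single_eq_of_ne h]
  · exact ofPath_apply_of_left_ne p b' ha

theorem ofPath_mul_ofPath {a b c : V} (q : Quiver.Path b c) (p : Quiver.Path a b) :
    ofPath K q * ofPath K p = ofPath K (p.comp q) := by
  ext1 a' c'
  rw [mul_apply, Finset.sum_eq_single b (fun b' _ hb => by
    rw [ofPath_apply_of_right_ne p a' hb, concat_zero_left]) (by simp)]
  obtain rfl | ha := eq_or_ne a' a
  · obtain rfl | hc := eq_or_ne c' c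
    · simp only [ofPath_apply_self, concat_single, mul_one]
    · rw [ofPath_apply_of_right_ne q b hc, ofPath_apply_of_right_ne _ _ hc, concat_zero_right]
  · rw [ofPath_apply_of_left_ne p b ha, ofPath_apply_of_left_ne _ _ ha, concat_zero_left]

theorem ofPath_mul_ofPath_of_ne {a b c d : V} (q : Quiver.Path c d) (p : Quiver.Path a b)
    (h : b ≠ c) : ofPath K q * ofPath K p = 0 := by
  ext1 a' d'
  rw [mul_apply, zero_apply]
  refine Finset.sum_eq_zero fun b' _ => ?_
  obtain rfl | hb := eq_or_ne b' b
  · rw [ofPath_apply_of_left_ne q d' h, concat_zero_right]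
  · rw [ofPath_apply_of_right_ne p a' hb, concat_zero_left]

theorem ofPath_cons {a b c : V} (p : Quiver.Path a b) (g : b ⟶ c) :
    ofPath K (p.cons g) = ofPath K g.toPath * ofPath K p := by
  rw [ofPath_mul_ofPath, Quiver.Path.comp_toPath_eq_cons]

theorem one_eq_sum_ofPath_nil :
    (1 : PathAlgebra K V) = ∑ a, ofPath K (Quiver.Path.nil : Quiver.Path a a) := by
  ext1 a b
  have hsum : (∑ c, ofPath K (Quiver.Path.nil : Quiver.Path c c)) a b =
      ∑ c, ofPath K (Quiver.Path.nil : Quiver.Path c c) a b :=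
    (congrFun (Finset.sum_apply a _ _) b).trans (Finset.sum_apply b _ _)
  rw [hsum, Finset.sum_eq_single a (fun c _ hc => ofPath_apply_of_left_ne _ _ hc.symm) (by simp),
    one_apply]
  obtain rfl | h := eq_or_ne a b
  · rw [trivialPath_self, ofPath_apply_self]
  · rw [trivialPath_ne h, ofPath_apply_of_right_ne _ _ h.symm]

theorem linearMap_ext {A : Type u} [AddCommGroup A] [Module K A] {f g : PathAlgebra K V →ₗ[K] A}
    (h : ∀ ⦃a b : V⦄ (p : Quiver.Path a b), f (ofPath K p) = g (ofPath K p)) : f = g :=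
  (pathBasis K V).ext fun i => h i.2.2

theorem map_mul_of_ofPath {A : Type u} [Ring A] [Algebra K A] (f : PathAlgebra K V →ₗ[K] A)
    (comp : ∀ ⦃a b c : V⦄ (q : Quiver.Path b c) (p : Quiver.Path a b),
      f (ofPath K (p.comp q)) = f (ofPath K q) * f (ofPath K p))
    (ne : ∀ ⦃a b c d : V⦄ (q : Quiver.Path c d) (p : Quiver.Path a b), b ≠ c →
      f (ofPath K q) * f (ofPath K p) = 0) (x y : PathAlgebra K V) :
    f (x * y) = f x * f y := by
  refine (LinearMap.map_mul_iff f).2 ?_ x y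
  refine linearMap_ext fun c d q => linearMap_ext fun a b p => ?_
  change f (ofPath K q * ofPath K p) = f (ofPath K q) * f (ofPath K p)
  obtain rfl | h := eq_or_ne b c
  · rw [ofPath_mul_ofPath, comp]
  · rw [ofPath_mul_ofPath_of_ne q p h, map_zero, ne q p h]

theorem map_mul_of_mapPath {W : Type u} [Quiver.{u} W] [Fintype W] {F : V ⥤q W}
    (hF : Function.Injective F.obj) {f : PathAlgebra K V →ₗ[K] PathAlgebra K W}
    (hf : ∀ ⦃a b : V⦄ (p : Quiver.Path a b), f (ofPath K p) = ofPath K (F.mapPath p))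
    (x y : PathAlgebra K V) : f (x * y) = f x * f y := by
  refine map_mul_of_ofPath f (fun a b c q p => ?_) (fun a b c d q p h => ?_) x y
  · rw [hf, hf, hf, ofPath_mul_ofPath, Prefunctor.mapPath_comp]
  · rw [hf, hf, ofPath_mul_ofPath_of_ne _ _ (hF.ne h)]

theorem ofPath_mapPath_apply_obj {W : Type u} [Quiver.{u} W] [Fintype W] {F : V ⥤q W}
    (hF : Function.Injective F.obj) {a b : V} (p : Quiver.Path a b) (c d : V) :
    ofPath K (F.mapPath p) (F.obj c) (F.obj d) =
      Finsupp.mapDomain (fun q => F.mapPath q) (ofPath K p c d) := by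
  obtain rfl | hc := eq_or_ne c a
  · obtain rfl | hd := eq_or_ne d b
    · rw [ofPath_apply_self, ofPath_apply_self, Finsupp.mapDomain_single]
    · rw [ofPath_apply_of_right_ne p c hd, ofPath_apply_of_right_ne _ _ (hF.ne hd),
        Finsupp.mapDomain_zero]
  · rw [ofPath_apply_of_left_ne p d hc, ofPath_apply_of_left_ne _ _ (hF.ne hc),
      Finsupp.mapDomain_zero]

theorem mem_of_ofPath_mem {P : Submodule K (PathAlgebra K V)}
    (h : ∀ ⦃a b : V⦄ (p : Quiver.Path a b), ofPath K p ∈ P) (x : PathAlgebra K V) : x ∈ P := by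
  have hP : (⊤ : Submodule K (PathAlgebra K V)) ≤ P := by
    rw [← (pathBasis K V).span_eq, Submodule.span_le]
    rintro _ ⟨i, rfl⟩
    exact h i.2.2
  exact hP trivial

end Paths

/-- A representation of the quiver on `V` by elements of the ring `A`: orthogonal idempotents of
sum `1` for the vertices, and elements of the corresponding Peirce components for the arrows. -/
structure Family (V A : Type u) [Quiver.{u} V] [Fintype V] [Ring A] where
  vertex : V → A
  arrow : ∀ ⦃a b : V⦄, (a ⟶ b) → A
  sum_vertex : ∑ a, vertex a = 1
  vertex_mul_of_ne : ∀ a b, a ≠ b → vertex a * vertex b = 0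
  vertex_mul_arrow : ∀ ⦃a b : V⦄ (g : a ⟶ b), vertex b * arrow g = arrow g
  arrow_mul_vertex : ∀ ⦃a b : V⦄ (g : a ⟶ b), arrow g * vertex a = arrow g

namespace Family

variable {K V A : Type u} [Field K] [Quiver.{u} V] [Fintype V] [Ring A] (F : Family V A)

/-- The element represented by a path. -/
def path {a : V} : ∀ {b : V}, Quiver.Path a b → A
  | _, .nil => F.vertex a
  | _, .cons p g => F.arrow g * path p

theorem vertex_mul_self (a : V) : F.vertex a * F.vertex a = F.vertex a := by
  have h := mul_one (F.vertex a)
  rwa [← F.sum_vertex, Finset.mul_sum, Finset.sum_eq_single a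
    (fun b _ hb => F.vertex_mul_of_ne a b hb.symm) (by simp)] at h

theorem path_mul_vertex {a b : V} (p : Quiver.Path a b) : F.path p * F.vertex a = F.path p := by
  induction p with
  | nil => exact F.vertex_mul_self a
  | cons p g h => rw [path, mul_assoc, h]

theorem vertex_mul_path {a b : V} (p : Quiver.Path a b) : F.vertex b * F.path p = F.path p := by
  cases p with
  | nil => exact F.vertex_mul_self a
  | cons p g => rw [path, ← mul_assoc, F.vertex_mul_arrow]

theorem path_comp {a b c : V} (p : Quiver.Path a b) (q : Quiver.Path b c) :
    F.path (p.comp q) = F.path q * F.path p := by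
  induction q with
  | nil => exact (F.vertex_mul_path p).symm
  | cons q g h => rw [Quiver.Path.comp_cons, path, path, h, mul_assoc]

theorem path_mul_path_of_ne {a b c d : V} (q : Quiver.Path c d) (p : Quiver.Path a b)
    (h : b ≠ c) : F.path q * F.path p = 0 := by
  rw [← F.path_mul_vertex q, ← F.vertex_mul_path p, mul_assoc, ← mul_assoc (F.vertex c),
    F.vertex_mul_of_ne c b h.symm, zero_mul, mul_zero]

variable [Algebra K A]

variable (K) in
/-- The linear extension of `Family.path` to the path algebra. -/
def liftLinear : PathAlgebra K V →ₗ[K] A := (pathBasis K V).constr K fun i => F.path i.2.2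

theorem liftLinear_ofPath {a b : V} (p : Quiver.Path a b) :
    F.liftLinear K (ofPath K p) = F.path p :=
  (pathBasis K V).constr_basis K _ _

variable (K) in
/-- The homomorphism from the path algebra given by a representation of the quiver. -/
def lift : PathAlgebra K V →ₐ[K] A :=
  AlgHom.ofLinearMap (F.liftLinear K)
    (by simp only [one_eq_sum_ofPath_nil, map_sum, liftLinear_ofPath, path, F.sum_vertex])
    (map_mul_of_ofPath _
      (fun a b c q p => by simp only [liftLinear_ofPath, path_comp])
      (fun a b c d q p h => by simp only [liftLinear_ofPath, F.path_mul_path_of_ne q p h]))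

@[simp]
theorem lift_ofPath {a b : V} (p : Quiver.Path a b) : F.lift K (ofPath K p) = F.path p :=
  F.liftLinear_ofPath p

end Family

end PathAlgebra

/-! ## The glued path algebra -/

section Gluing

open PathAlgebra Quiver

variable {K V' V'' : Type u} [Field K] [Quiver.{u} V'] [Quiver.{u} V''] (v : V') (w : V'')
  [Fintype V'] [Fintype V'']

variable (K) in
/-- The inclusion `KQ' → KQ` as a linear map. -/
def pathAlgebraInlₗ : PathAlgebra K V' →ₗ[K] PathAlgebra K (GluedVertex v w) where
  toFun := pathAlgebraInl v w
  map_add' x y := by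
    ext1 a b
    rcases a with a | a <;> rcases b with b | b
    exacts [Finsupp.mapDomain_add, (add_zero _).symm, (add_zero _).symm, (add_zero _).symm]
  map_smul' r x := by
    ext1 a b
    rcases a with a | a <;> rcases b with b | b
    exacts [Finsupp.mapDomain_smul _ _, (smul_zero r).symm, (smul_zero r).symm,
      (smul_zero r).symm]

variable (K) in
/-- The inclusion `KQ'' → KQ` as a linear map. -/
def pathAlgebraInrₗ : PathAlgebra K V'' →ₗ[K] PathAlgebra K (GluedVertex v w) where
  toFun := pathAlgebraInr v w
  map_add' x y := by
    ext1 a b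
    rcases a with a | a <;> rcases b with b | b
    exacts [(add_zero _).symm, (add_zero _).symm, (add_zero _).symm, Finsupp.mapDomain_add]
  map_smul' r x := by
    ext1 a b
    rcases a with a | a <;> rcases b with b | b
    exacts [(smul_zero r).symm, (smul_zero r).symm, (smul_zero r).symm,
      Finsupp.mapDomain_smul _ _]

theorem pathAlgebraInlₗ_ofPath {a b : V'} (p : Path a b) :
    pathAlgebraInlₗ K v w (ofPath K p) = ofPath K ((gluedInl v w).mapPath p) := by
  ext1 c d
  rcases c with c | c <;> rcases d with d | d
  · exact (ofPath_mapPath_apply_obj (F := gluedInl v w) Sum.inl_injective p c d).symm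
  · exact (ofPath_apply_of_right_ne ((gluedInl v w).mapPath p) _ Sum.inr_ne_inl).symm
  · exact (ofPath_apply_of_left_ne ((gluedInl v w).mapPath p) _ Sum.inr_ne_inl).symm
  · exact (ofPath_apply_of_left_ne ((gluedInl v w).mapPath p) _ Sum.inr_ne_inl).symm

theorem pathAlgebraInrₗ_ofPath {a b : V''} (p : Path a b) :
    pathAlgebraInrₗ K v w (ofPath K p) = ofPath K ((gluedInr v w).mapPath p) := by
  ext1 c d
  rcases c with c | c <;> rcases d with d | d
  · exact (ofPath_apply_of_left_ne ((gluedInr v w).mapPath p) _ Sum.inl_ne_inr).symm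
  · exact (ofPath_apply_of_left_ne ((gluedInr v w).mapPath p) _ Sum.inl_ne_inr).symm
  · exact (ofPath_apply_of_right_ne ((gluedInr v w).mapPath p) _ Sum.inl_ne_inr).symm
  · exact (ofPath_mapPath_apply_obj (F := gluedInr v w) Sum.inr_injective p c d).symm

theorem pathAlgebraInlₗ_mul (x y : PathAlgebra K V') :
    pathAlgebraInlₗ K v w (x * y) = pathAlgebraInlₗ K v w x * pathAlgebraInlₗ K v w y :=
  map_mul_of_mapPath Sum.inl_injective (fun _ _ p => pathAlgebraInlₗ_ofPath v w p) x y

theorem pathAlgebraInrₗ_mul (x y : PathAlgebra K V'') :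
    pathAlgebraInrₗ K v w (x * y) = pathAlgebraInrₗ K v w x * pathAlgebraInrₗ K v w y :=
  map_mul_of_mapPath Sum.inr_injective (fun _ _ p => pathAlgebraInrₗ_ofPath v w p) x y

theorem pathAlgebraInlₗ_mul_pathAlgebraInrₗ (x : PathAlgebra K V') (y : PathAlgebra K V'') :
    pathAlgebraInlₗ K v w x * pathAlgebraInrₗ K v w y = 0 := by
  ext1 a c
  rw [mul_apply]
  refine Finset.sum_eq_zero fun b _ => ?_
  rcases b with b | b
  · rcases a with a | a <;> exact concat_zero_left _
  · exact concat_zero_right _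

theorem pathAlgebraInrₗ_mul_pathAlgebraInlₗ (x : PathAlgebra K V'') (y : PathAlgebra K V') :
    pathAlgebraInrₗ K v w x * pathAlgebraInlₗ K v w y = 0 := by
  ext1 a c
  rw [mul_apply]
  refine Finset.sum_eq_zero fun b _ => ?_
  rcases b with b | b
  · exact concat_zero_right _
  · rcases a with a | a <;> exact concat_zero_left _

theorem pathAlgebraInlₗ_one_add_pathAlgebraInrₗ_one :
    pathAlgebraInlₗ K v w 1 + pathAlgebraInrₗ K v w 1 = 1 := by
  simp only [one_eq_sum_ofPath_nil, map_sum, pathAlgebraInlₗ_ofPath, pathAlgebraInrₗ_ofPath]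
  exact (Fintype.sum_sum_type fun a : V' ⊕ V'' =>
    ofPath K (Path.nil : Path (V := GluedVertex v w) a a)).symm

variable (K) in
/-- The inclusion `KQ' × KQ'' → KQ`. -/
def gluedIncl : PathAlgebra K V' × PathAlgebra K V'' →ₐ[K] PathAlgebra K (GluedVertex v w) :=
  AlgHom.ofLinearMap ((pathAlgebraInlₗ K v w).coprod (pathAlgebraInrₗ K v w))
    (pathAlgebraInlₗ_one_add_pathAlgebraInrₗ_one v w)
    fun x y => by
      simp only [LinearMap.coprod_apply, Prod.fst_mul, Prod.snd_mul, pathAlgebraInlₗ_mul,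
        pathAlgebraInrₗ_mul, mul_add, add_mul, pathAlgebraInlₗ_mul_pathAlgebraInrₗ,
        pathAlgebraInrₗ_mul_pathAlgebraInlₗ, add_zero, zero_add]

theorem gluedIncl_inl (x : PathAlgebra K V') : gluedIncl K v w (x, 0) = pathAlgebraInl v w x :=
  (congrArg _ (map_zero (pathAlgebraInrₗ K v w))).trans (add_zero _)

theorem gluedIncl_inr (y : PathAlgebra K V'') : gluedIncl K v w (0, y) = pathAlgebraInr v w y :=
  (congrArg (· + _) (map_zero (pathAlgebraInlₗ K v w))).trans (zero_add _)

theorem gluedIncl_ofPath_inl {a b : V'} (p : Path a b) :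
    gluedIncl K v w (ofPath K p, 0) = ofPath K ((gluedInl v w).mapPath p) :=
  (gluedIncl_inl v w _).trans (pathAlgebraInlₗ_ofPath v w p)

theorem gluedIncl_ofPath_inr {a b : V''} (p : Path a b) :
    gluedIncl K v w (0, ofPath K p) = ofPath K ((gluedInr v w).mapPath p) :=
  (gluedIncl_inr v w _).trans (pathAlgebraInrₗ_ofPath v w p)

variable (K) in
/-- The new arrow, as an element of the path algebra. -/
def gluedBridge : PathAlgebra K (GluedVertex v w) :=
  ofPath K (Hom.toPath (V := GluedVertex v w) (a := Sum.inr w) (b := Sum.inl v) GluedArrow.bridge)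

theorem adjoin_gluedIncl_gluedBridge :
    Algebra.adjoin K (Set.range (gluedIncl K v w) ∪ {gluedBridge K v w}) = ⊤ := by
  have hl {a b : V'} (p : Path a b) : ofPath K ((gluedInl v w).mapPath p) ∈
      Algebra.adjoin K (Set.range (gluedIncl K v w) ∪ {gluedBridge K v w}) :=
    Algebra.subset_adjoin (Or.inl ⟨_, gluedIncl_ofPath_inl v w p⟩)
  have hr {a b : V''} (p : Path a b) : ofPath K ((gluedInr v w).mapPath p) ∈
      Algebra.adjoin K (Set.range (gluedIncl K v w) ∪ {gluedBridge K v w}) :=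
    Algebra.subset_adjoin (Or.inl ⟨_, gluedIncl_ofPath_inr v w p⟩)
  refine Algebra.eq_top_iff.2 (mem_of_ofPath_mem (P := Subalgebra.toSubmodule
    (Algebra.adjoin K (Set.range (gluedIncl K v w) ∪ {gluedBridge K v w}))) fun a b p => ?_)
  induction p with
  | nil =>
    rcases a with a | a
    exacts [hl (Path.nil (a := a)), hr (Path.nil (a := a))]
  | cons p g hp =>
    rw [ofPath_cons]
    refine Subalgebra.mul_mem _ ?_ hp
    change GluedArrow v w _ _ at g
    cases g with
    | left g => exact hl g.toPath
    | right g => exact hr g.toPath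
    | bridge => exact Algebra.subset_adjoin (Or.inr rfl)

variable {v w}

/-- The representation of the glued quiver which is given on `Q'` and `Q''` by a homomorphism from
`KQ' × KQ''` and which sends the new arrow to `a`. -/
def gluedFamily {A : Type u} [Ring A] [Algebra K A]
    (φ : PathAlgebra K V' × PathAlgebra K V'' →ₐ[K] A) (a : A)
    (hφ : φ (ofPath K (Path.nil : Path v v), 0) * a = a)
    (hψ : a * φ (0, ofPath K (Path.nil : Path w w)) = a) : Family (GluedVertex v w) A where
  vertex := Sum.elim (fun x : V' => φ (ofPath K (Path.nil : Path x x), 0))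
    (fun y : V'' => φ (0, ofPath K (Path.nil : Path y y)))
  arrow _ _ g := match g with
    | GluedArrow.left g => φ (ofPath K g.toPath, 0)
    | GluedArrow.right g => φ (0, ofPath K g.toPath)
    | GluedArrow.bridge => a
  sum_vertex := by
    refine (Fintype.sum_sum_type _).trans ?_
    simp only [Sum.elim_inl, Sum.elim_inr]
    rw [← map_sum, ← map_sum, ← map_add, ← map_one φ]
    refine congrArg φ (Prod.ext ?_ ?_)
    · simp [Prod.fst_sum, one_eq_sum_ofPath_nil]
    · simp [Prod.snd_sum, one_eq_sum_ofPath_nil]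
  vertex_mul_of_ne x y h := by
    rcases x with x | x <;> rcases y with y | y <;>
      refine (map_mul φ _ _).symm.trans ((congrArg φ ?_).trans (map_zero φ))
    exacts [Prod.ext (ofPath_mul_ofPath_of_ne _ _ fun h' => h (congrArg Sum.inl h'.symm))
      (mul_zero _), Prod.ext (mul_zero _) (zero_mul _), Prod.ext (zero_mul _) (mul_zero _),
      Prod.ext (mul_zero _) (ofPath_mul_ofPath_of_ne _ _ fun h' => h (congrArg Sum.inr h'.symm))]
  vertex_mul_arrow x y g := by
    change GluedArrow v w x y at g
    cases g with
    | left g =>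
      exact (map_mul φ _ _).symm.trans
        (congrArg φ (Prod.ext (ofPath_mul_ofPath _ _) (mul_zero _)))
    | right g =>
      exact (map_mul φ _ _).symm.trans
        (congrArg φ (Prod.ext (mul_zero _) (ofPath_mul_ofPath _ _)))
    | bridge => exact hφ
  arrow_mul_vertex x y g := by
    change GluedArrow v w x y at g
    cases g with
    | left g =>
      exact (map_mul φ _ _).symm.trans
        (congrArg φ (Prod.ext (ofPath_mul_ofPath _ _) (mul_zero _)))
    | right g =>
      exact (map_mul φ _ _).symm.trans
        (congrArg φ (Prod.ext (mul_zero _) (ofPath_mul_ofPath _ _)))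
    | bridge => exact hψ

theorem exists_glued_lift {A : Type u} [Ring A] [Algebra K A]
    (φ : PathAlgebra K V' × PathAlgebra K V'' →ₐ[K] A) (a : A)
    (hφ : φ (ofPath K (Path.nil : Path v v), 0) * a = a)
    (hψ : a * φ (0, ofPath K (Path.nil : Path w w)) = a) :
    ∃ ρ : PathAlgebra K (GluedVertex v w) →ₐ[K] A,
      (∀ s, ρ (gluedIncl K v w s) = φ s) ∧ ρ (gluedBridge K v w) = a := by
  let F := gluedFamily φ a hφ hψ
  have hl {a b : V'} (p : Path a b) : F.path ((gluedInl v w).mapPath p) = φ (ofPath K p, 0) := by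
    induction p with
    | nil => rfl
    | cons p g hp =>
      refine (congrArg (F.arrow (GluedArrow.left g) * ·) hp).trans ((map_mul φ _ _).symm.trans ?_)
      rw [Prod.mk_mul_mk, mul_zero, ← ofPath_cons]
  have hr {a b : V''} (p : Path a b) : F.path ((gluedInr v w).mapPath p) = φ (0, ofPath K p) := by
    induction p with
    | nil => rfl
    | cons p g hp =>
      refine (congrArg (F.arrow (GluedArrow.right g) * ·) hp).trans ((map_mul φ _ _).symm.trans ?_)
      rw [Prod.mk_mul_mk, mul_zero, ← ofPath_cons]
  have h : ((F.lift K).comp (gluedIncl K v w)).toLinearMap = φ.toLinearMap := by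
    refine LinearMap.prod_ext (linearMap_ext fun a b p => ?_) (linearMap_ext fun a b p => ?_)
    · exact (congrArg _ (gluedIncl_ofPath_inl v w p)).trans ((F.lift_ofPath _).trans (hl p))
    · exact (congrArg _ (gluedIncl_ofPath_inr v w p)).trans ((F.lift_ofPath _).trans (hr p))
  exact ⟨F.lift K, fun s => LinearMap.congr_fun h s, (F.lift_ofPath _).trans hψ⟩

variable (K v w) in
/-- The path algebra of the glued quiver is obtained from the product of the path algebras of the
two quivers by adjoining the new arrow. -/
def gluedPathExtension :
    ArrowExtension K (PathAlgebra K V' × PathAlgebra K V'') (PathAlgebra K (GluedVertex v w)) where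
  ι := gluedIncl K v w
  arrow := gluedBridge K v w
  e := (ofPath K (Path.nil : Path v v), 0)
  f := (0, ofPath K (Path.nil : Path w w))
  e_mul_e := Prod.ext (ofPath_mul_ofPath _ _) (mul_zero _)
  f_mul_f := Prod.ext (mul_zero _) (ofPath_mul_ofPath _ _)
  f_mul_mul_e s := Prod.ext
    ((congrArg (· * _) (zero_mul s.1)).trans (zero_mul _)) (mul_zero _)
  e_mul_arrow := by
    rw [gluedIncl_ofPath_inl]
    exact ofPath_mul_ofPath _ _
  arrow_mul_f := by
    rw [gluedIncl_ofPath_inr]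
    exact ofPath_mul_ofPath _ _
  adjoin_eq_top := adjoin_gluedIncl_gluedBridge v w
  exists_lift := exists_glued_lift

variable (v w) (I' : TwoSidedIdeal (PathAlgebra K V')) (I'' : TwoSidedIdeal (PathAlgebra K V''))

theorem gluedIdeal_eq_span :
    gluedIdeal v w I' I'' = TwoSidedIdeal.span (gluedIncl K v w '' {s | s.1 ∈ I' ∧ s.2 ∈ I''}) := by
  refine le_antisymm (TwoSidedIdeal.span_le.2 ?_) (TwoSidedIdeal.span_le.2 ?_)
  · rintro _ (⟨x, hx, rfl⟩ | ⟨y, hy, rfl⟩)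
    · exact TwoSidedIdeal.subset_span ⟨(x, 0), ⟨hx, I''.zero_mem⟩, gluedIncl_inl v w x⟩
    · exact TwoSidedIdeal.subset_span ⟨(0, y), ⟨I'.zero_mem, hy⟩, gluedIncl_inr v w y⟩
  · rintro _ ⟨s, ⟨hx, hy⟩, rfl⟩
    exact add_mem (TwoSidedIdeal.subset_span (Or.inl ⟨s.1, hx, rfl⟩))
      (TwoSidedIdeal.subset_span (Or.inr ⟨s.2, hy, rfl⟩))

variable (K) in
theorem mkₐ_eq_zero_iff {R : Type u} [Ring R] [Algebra K R] (I : TwoSidedIdeal R) (x : R) :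
    RingCon.mkₐ K I.ringCon x = 0 ↔ x ∈ I :=
  (RingCon.eq I.ringCon).trans (I.mem_iff x).symm

/-- The algebra of the glued bound quiver is obtained from the product of the algebras of the two
bound quivers by adjoining the new arrow. -/
def gluedExtension : ArrowExtension K (BoundQuiverAlgebra I' × BoundQuiverAlgebra I'')
    (BoundQuiverAlgebra (gluedIdeal v w I' I'')) :=
  (gluedPathExtension K v w).ofSurjective
    (π := (RingCon.mkₐ K I'.ringCon).prodMap (RingCon.mkₐ K I''.ringCon))
    ((RingCon.mk'_surjective _).prodMap (RingCon.mk'_surjective _))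
    (ϖ := RingCon.mkₐ K (gluedIdeal v w I' I'').ringCon) (RingCon.mk'_surjective _) <| by
      refine Eq.trans (TwoSidedIdeal.ext fun x => ?_) ((gluedIdeal_eq_span v w I' I'').trans
        (congrArg _ (congrArg _ (Set.ext fun s => ?_))))
      · exact (TwoSidedIdeal.mem_ker _).trans (mkₐ_eq_zero_iff K _ x)
      · exact (Prod.ext_iff.trans (and_congr (mkₐ_eq_zero_iff K I' s.1)
          (mkₐ_eq_zero_iff K I'' s.2))).symm

end Gluing

theorem lemma3p7_general (K V' V'' : Type u) [Field K] [Fintype V'] [Fintype V'']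
    [Quiver.{u} V'] [Quiver.{u} V''] (v : V') (w : V'')
    (I' : TwoSidedIdeal (PathAlgebra K V')) (I'' : TwoSidedIdeal (PathAlgebra K V'')) :
    Nonempty (TriangleEquivalence K
      (StableGProj (BoundQuiverAlgebra (gluedIdeal v w I' I'')))
      (StableGProj (BoundQuiverAlgebra I') × StableGProj (BoundQuiverAlgebra I''))) :=
  ⟨(gluedExtension v w I' I'').triangleEquivalence.trans (ProductRing.triangleEquivalence _ _ K)⟩

end

theorem lemma3p7 (K V' V'' : Type u) [Field K] [Fintype V'] [Fintype V'']
    [Quiver.{u} V'] [Quiver.{u} V''] (v : V') (w : V'')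
    (I' : TwoSidedIdeal (PathAlgebra K V')) (I'' : TwoSidedIdeal (PathAlgebra K V''))
    (hB : IsGorensteinAlgebra K (BoundQuiverAlgebra I'))
    (hC : IsGorensteinAlgebra K (BoundQuiverAlgebra I'')) :
    Nonempty (TriangleEquivalence K
      (StableGProj (BoundQuiverAlgebra (gluedIdeal v w I' I'')))
      (StableGProj (BoundQuiverAlgebra I') × StableGProj (BoundQuiverAlgebra I''))) :=
  lemma3p7_general K V' V'' v w I' I''
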